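/- **Setting.** Let $\mathbb D=\{z\in\mathbb C:|z|<1\}$. For a finite index set $\Lambda$ let $\mathbb P_\Lambda$ be the set of probability vectors $p=(p_i)_{i\in\Lambda}$ with all $p_i>0$. For $\lambda\in\mathbb D$, $\mathbf a=(a_i)_{i\in\Lambda}\in\mathbb C^\Lambda$ and $p\in\mathbb P_\Lambda$, let $\nu^p_{\lambda,\mathbf a}$ be the unique Borel probability measure on $\mathbb C$ with $\nu^p_{\lambda,\mathbf a}=\sum_{i\in\Lambda}p_i\,(f_i)_*\nu^p_{\lambda,\mathbf a}$, where $f_i(z)=\lambda z+a_i$. Write $\widehat{\mu}(\xi)=\int_{\mathbb C} e^{2\pi i\,\mathrm{Re}(z\overline{\xi})}\,d\mu(z)$, let $\dim_H$ be Hausdorff dimension, and say that $\mu\in C^k$ if $\mu$ is absolutely continuous with respect to Lebesgue measure on $\mathbb C\cong\mathbb R^2$ with a density that has a $C^k$ version. **Theorem.** (i) There is a set $E\subset\mathbb D\setminus\mathbb R$ with $\dim_H E=0$ such that for every finite $\Lambda$, every $\mathbf a\in\mathbb C^\Lambda$ with not all $a_i$ equal, every $p\in\mathbb P_\Lambda$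 and every $\lambda\in\mathbb D\setminus(E\cup\mathbb R)$ there are $C,\gamma>0$ (depending on $\lambda,\mathbf a,p$) with $$|\widehat{\nu^p_{\lambda,\mathbf a}}(\xi)|\le C\,|\xi|^{-\gamma}\quad\text{for all }\xi\in\mathbb C\setminus\{0\}.\qquad(*)$$ More precisely, let $\varepsilon>0$, $1<b_1<b_2$, $\eta>0$ and $H=H_{b_1,b_2,\eta}=\{z\in\mathbb C: b_1\le|z|\le b_2,\ \mathrm{Im}\,z>\eta\}$. Then there is a set $\mathcal E\subset H$ with $\dim_H\mathcal E<\varepsilon$ such that for every finite $\Lambda$ and every $p\in\mathbb P_\Lambda$ there is $\gamma>0$ with the following property: for every $\mathbf a\in\mathbb C^\Lambda$ with not all $a_i$ equal and every $\lambda$ with $\lambda^{-1}\in H\setminus\mathcal E$, there is $C>0$ (depending on $\lambda,\mathbf a,p$) such that $(*)$ holds. (ii) For every $\lambda\in\mathbb D\setminus\mathbb R$ there is a set $E\subset\mathbb C$ with $\dim_H E=0$ such that, whenever $\Lambda$ is finite with $\#\Lambda\ge3$, $p\in\mathbb P_\Lambda$, and $\mathbf a\in\mathbb C^\Lambda$ satisfies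 $a_i\ne a_j$ and $(a_k-a_i)/(a_j-a_i)\notin E$ for some distinct $i,j,k\in\Lambda$, there are $C,\gamma>0$ (depending on $\lambda,\mathbf a,p$) such that $(*)$ holds. (iii) For every integer $k\ge 0$, every $\eta>0$, every finite $\Lambda$ with $\#\Lambda\ge2$, every $p\in\mathbb P_\Lambda$ and every $\mathbf a\in\mathbb C^\Lambda$ with all $a_i$ different, $$\lim_{\delta\to0^+}\dim_H\bigl(\{\lambda\in\mathbb C\setminus\mathbb R:\ |\lambda|\in(1-\delta,1),\ |\mathrm{Im}\,\lambda|>\eta,\ \nu^p_{\lambda,\mathbf a}\notin C^k\}\bigr)=0.$$ -/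

import Mathlib

open MeasureTheory Filter Topology Set

universe u

noncomputable section

/-- The open simplex of strictly positive probability vectors indexed by `Λ`. -/
def openSimplex (Λ : Type u) [Fintype Λ] : Set (Λ → ℝ) :=
  {p | (∀ i, 0 < p i) ∧ ∑ i, p i = 1}

/-- `μ` is a self-similar measure for the iterated function system `z ↦ lam * z + a i` with
weights `p i`: a Borel probability measure with `μ = ∑ i, p i • (f i)_* μ`. -/
def IsSelfSimilarMeasure {Λ : Type u} [Fintype Λ] (lam : ℂ) (a : Λ → ℂ) (p : Λ → ℝ)
    (μ : Measure ℂ) : Prop :=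
  IsProbabilityMeasure μ ∧
    μ = ∑ i, ENNReal.ofReal (p i) • μ.map (fun z => lam * z + a i)

/-- The measure on the index set giving mass `p i` to `i`. -/
def weightMeasure {Λ : Type u} [Fintype Λ] [MeasurableSpace Λ] (p : Λ → ℝ) : Measure Λ :=
  ∑ i, ENNReal.ofReal (p i) • Measure.dirac i

/-- The self-similar measure `ν_{lam, a}^p`, constructed as the law of `∑ n, lam ^ n * a (ω n)` for
independent indices `ω n` with distribution `p`. By `isSelfSimilarMeasure_iff` it is the only
self-similar measure when `‖lam‖ < 1` and `p ∈ openSimplex Λ`. -/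
def selfSimilarMeasure {Λ : Type u} [Fintype Λ] (lam : ℂ) (a : Λ → ℂ) (p : Λ → ℝ) : Measure ℂ :=
  letI : MeasurableSpace Λ := ⊤
  (Measure.infinitePi (fun _ : ℕ => weightMeasure p)).map (fun ω => ∑' n, lam ^ n * a (ω n))

theorem weightMeasure_isProbabilityMeasure {Λ : Type u} [Fintype Λ] [MeasurableSpace Λ]
    {p : Λ → ℝ} (hp : p ∈ openSimplex Λ) : IsProbabilityMeasure (weightMeasure p) := by
  constructor
  simp only [weightMeasure, Measure.coe_finsetSum, Finset.sum_apply, Measure.smul_apply,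
    measure_univ, smul_eq_mul, mul_one]
  rw [← ENNReal.ofReal_sum_of_nonneg (fun i _ => (hp.1 i).le), hp.2, ENNReal.ofReal_one]

theorem summable_coding {Λ : Type u} [Fintype Λ] {lam : ℂ} (hlam : ‖lam‖ < 1) (a : Λ → ℂ)
    (ω : ℕ → Λ) : Summable (fun n => lam ^ n * a (ω n)) := by
  refine Summable.of_norm_bounded (g := fun n => ‖lam‖ ^ n * ∑ i, ‖a i‖)
    ((summable_geometric_of_lt_one (norm_nonneg _) hlam).mul_right _) fun n => ?_
  rw [norm_mul, norm_pow]
  gcongr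
  exact Finset.single_le_sum (f := fun i => ‖a i‖) (fun i _ => norm_nonneg _) (Finset.mem_univ _)

theorem measurable_coding {Λ : Type u} [Fintype Λ] [MeasurableSpace Λ] [DiscreteMeasurableSpace Λ]
    {lam : ℂ} (hlam : ‖lam‖ < 1) (a : Λ → ℂ) :
    Measurable (fun ω : ℕ → Λ => ∑' n, lam ^ n * a (ω n)) := by
  refine measurable_of_tendsto_metrizable
    (f := fun N (ω : ℕ → Λ) => ∑ n ∈ Finset.range N, lam ^ n * a (ω n)) (fun N => ?_) ?_
  · refine Finset.measurable_sum _ fun n _ => ?_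
    exact ((Measurable.of_discrete (f := a)).comp (measurable_pi_apply n)).const_mul _
  · rw [tendsto_pi_nhds]
    exact fun ω => (summable_coding hlam a ω).hasSum.tendsto_sum_nat

/-- Prepending an independent digit to an i.i.d. sequence gives an i.i.d. sequence. -/
theorem infinitePi_map_cons {Λ : Type u} [MeasurableSpace Λ] (P : Measure Λ)
    [IsProbabilityMeasure P] :
    (P.prod (Measure.infinitePi (fun _ : ℕ => P))).map
      (fun x : Λ × (ℕ → Λ) => (fun n => Nat.casesOn n x.1 x.2 : ℕ → Λ)) =
    Measure.infinitePi (fun _ : ℕ => P) := by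
  have hm : Measurable (fun x : Λ × (ℕ → Λ) => (fun n => Nat.casesOn n x.1 x.2 : ℕ → Λ)) := by
    refine measurable_pi_lambda _ fun n => ?_
    cases n with
    | zero => exact measurable_fst
    | succ n => exact (measurable_pi_apply n).comp measurable_snd
  apply Measure.eq_infinitePi
  intro s t ht
  rw [Measure.map_apply hm (MeasurableSet.pi s.countable_toSet fun i _ => ht i)]
  classical
  let t' : ℕ → Set Λ := fun n => if n ∈ s then t n else univ
  have ht' : ∀ n, MeasurableSet (t' n) := fun n => by
    simp only [t']; split_ifs
    exacts [ht n, .univ]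
  let s' : Finset ℕ := s.preimage Nat.succ (Nat.succ_injective.injOn)
  have hset : (fun x : Λ × (ℕ → Λ) => (fun n => Nat.casesOn n x.1 x.2 : ℕ → Λ)) ⁻¹' (Set.pi s t) =
      (t' 0) ×ˢ (Set.pi s' fun n => t (n + 1)) := by
    ext x
    simp only [mem_preimage, Set.mem_pi, mem_prod, t', s', Finset.coe_preimage, Finset.mem_coe]
    constructor
    · intro h
      refine ⟨?_, fun i hi => h (i + 1) hi⟩
      split_ifs with h0
      · exact h 0 h0
      · trivial
    · rintro ⟨h0, h1⟩ i hi
      cases i with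
      | zero => simpa [hi] using h0
      | succ i => exact h1 i hi
  rw [hset, Measure.prod_prod, Measure.infinitePi_pi _ (fun i _ => ht _)]
  have h1 : ∏ i ∈ s', P (t (i + 1)) = ∏ i ∈ s.erase 0, P (t i) := by
    refine Finset.prod_bij (fun i _ => i + 1) ?_ ?_ ?_ ?_
    · intro i hi
      simpa [s'] using hi
    · intro i _ j _ h
      exact Nat.succ_injective h
    · intro i hi
      obtain ⟨h0, h1⟩ := Finset.mem_erase.1 hi
      obtain ⟨j, rfl⟩ := Nat.exists_eq_succ_of_ne_zero h0
      exact ⟨j, by simpa [s'] using h1, rfl⟩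
    · intro i _
      rfl
  rw [h1]
  by_cases h0 : 0 ∈ s
  · simp only [t', h0, if_true]
    exact Finset.mul_prod_erase s (fun i => P (t i)) h0
  · simp [t', h0]

theorem isSelfSimilarMeasure_selfSimilarMeasure {Λ : Type u} [Fintype Λ] {lam : ℂ}
    (hlam : ‖lam‖ < 1) (a : Λ → ℂ) {p : Λ → ℝ} (hp : p ∈ openSimplex Λ) :
    IsSelfSimilarMeasure lam a p (selfSimilarMeasure lam a p) := by
  let _ : MeasurableSpace Λ := ⊤
  have : DiscreteMeasurableSpace Λ := ⟨fun _ => trivial⟩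
  have := weightMeasure_isProbabilityMeasure hp
  have hX := measurable_coding hlam a
  set X : (ℕ → Λ) → ℂ := fun ω => ∑' n, lam ^ n * a (ω n) with hXdef
  set Q : Measure (ℕ → Λ) := Measure.infinitePi (fun _ : ℕ => weightMeasure p) with hQ
  have hν : selfSimilarMeasure lam a p = Q.map X := rfl
  refine ⟨hν ▸ Measure.isProbabilityMeasure_map hX.aemeasurable, ?_⟩
  have hf : ∀ i, Measurable (fun z : ℂ => lam * z + a i) := fun i => by fun_prop
  have hm : Measurable (fun x : Λ × (ℕ → Λ) => (fun n => Nat.casesOn n x.1 x.2 : ℕ → Λ)) := by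
    refine measurable_pi_lambda _ fun n => ?_
    cases n with
    | zero => exact measurable_fst
    | succ n => exact (measurable_pi_apply n).comp measurable_snd
  have hcomp : X ∘ (fun x : Λ × (ℕ → Λ) => (fun n => Nat.casesOn n x.1 x.2 : ℕ → Λ)) =
      fun x => lam * X x.2 + a x.1 := by
    funext x
    have := (summable_coding hlam a (fun n => Nat.casesOn n x.1 x.2 : ℕ → Λ)).tsum_eq_zero_add
    simp only [Function.comp, hXdef]
    rw [this, ← tsum_mul_left, add_comm]
    simp [pow_succ', mul_assoc]
  rw [hν]
  ext A hA
  have hmeas : MeasurableSet ((fun x : Λ × (ℕ → Λ) => lam * X x.2 + a x.1) ⁻¹' A) := by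
    rw [← hcomp]; exact (hX.comp hm) hA
  conv_lhs => rw [hQ, ← infinitePi_map_cons (weightMeasure p), ← hQ, Measure.map_map hX hm, hcomp,
    Measure.map_apply (hcomp ▸ hX.comp hm) hA, Measure.prod_apply hmeas]
  conv_lhs => rw [weightMeasure]
  rw [lintegral_finsetSum_measure]
  simp only [lintegral_smul_measure, lintegral_dirac, Measure.coe_finsetSum, Finset.sum_apply,
    Measure.smul_apply]
  refine Finset.sum_congr rfl fun i _ => ?_
  rw [Measure.map_apply (hf i) hA, Measure.map_apply hX (hf i hA)]
  rfl

theorem IsSelfSimilarMeasure.charFun_eq {Λ : Type u} [Fintype Λ] {lam : ℂ} {a : Λ → ℂ}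
    {p : Λ → ℝ} {μ : Measure ℂ} (h : IsSelfSimilarMeasure lam a p μ) (hp : p ∈ openSimplex Λ)
    (t : ℂ) :
    charFun μ t = (∑ i, (p i : ℂ) * Complex.exp (inner ℝ (a i) t * Complex.I)) *
      charFun μ ((starRingEnd ℂ) lam * t) := by
  have := h.1
  have hint : ∀ (ν : Measure ℂ) [IsFiniteMeasure ν],
      Integrable (fun x : ℂ => Complex.exp (inner ℝ x t * Complex.I)) ν := by
    intro ν _
    refine Integrable.of_bound (C := 1) ?_ (ae_of_all _ fun x => ?_)
    · exact Continuous.aestronglyMeasurable (by fun_prop)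
    · rw [Complex.norm_exp_ofReal_mul_I]
  rw [charFun_apply]
  conv_lhs => rw [h.2]
  rw [integral_finsetSum_measure (fun i _ => (hint _).smul_measure ENNReal.ofReal_ne_top),
    Finset.sum_mul]
  refine Finset.sum_congr rfl fun i _ => ?_
  rw [integral_smul_measure, integral_map (by fun_prop)
    (Continuous.aestronglyMeasurable (by fun_prop)), charFun_apply, ENNReal.toReal_ofReal (hp.1 i).le,
    mul_assoc, ← integral_const_mul, Complex.real_smul]
  congr 1
  refine integral_congr_ae (ae_of_all _ fun z => ?_)
  simp only
  rw [← Complex.exp_add, ← add_mul, ← Complex.ofReal_add]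
  congr 3
  simp only [Complex.inner]
  simp
  ring

/-- The self-similarity relation has exactly one solution among Borel probability measures. -/
theorem isSelfSimilarMeasure_iff {Λ : Type u} [Fintype Λ] {lam : ℂ} (hlam : ‖lam‖ < 1)
    (a : Λ → ℂ) {p : Λ → ℝ} (hp : p ∈ openSimplex Λ) (μ : Measure ℂ) :
    IsSelfSimilarMeasure lam a p μ ↔ μ = selfSimilarMeasure lam a p := by
  have hs := isSelfSimilarMeasure_selfSimilarMeasure hlam a hp
  refine ⟨fun h => ?_, fun h => h ▸ hs⟩
  have := h.1
  have := hs.1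
  set ν := selfSimilarMeasure lam a p
  apply Measure.ext_of_charFun
  have hle : ∀ t, ‖charFun μ t - charFun ν t‖ ≤
      ‖charFun μ ((starRingEnd ℂ) lam * t) - charFun ν ((starRingEnd ℂ) lam * t)‖ := by
    intro t
    rw [h.charFun_eq hp, hs.charFun_eq hp, ← mul_sub, norm_mul]
    refine mul_le_of_le_one_left (norm_nonneg _) ((norm_sum_le _ _).trans ?_)
    rw [← hp.2]
    refine Finset.sum_le_sum fun i _ => ?_
    rw [norm_mul, Complex.norm_exp_ofReal_mul_I, mul_one, Complex.norm_real, Real.norm_eq_abs,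
      abs_of_pos (hp.1 i)]
  funext t
  have hle' : ∀ n : ℕ, ‖charFun μ t - charFun ν t‖ ≤
      ‖charFun μ ((starRingEnd ℂ) lam ^ n * t) - charFun ν ((starRingEnd ℂ) lam ^ n * t)‖ := by
    intro n
    induction n with
    | zero => simp
    | succ n ih =>
      refine ih.trans ((hle _).trans (le_of_eq ?_))
      rw [← mul_assoc, ← pow_succ']
  have hlim : Tendsto (fun n : ℕ => (starRingEnd ℂ) lam ^ n * t) atTop (𝓝 0) := by
    have : Tendsto (fun n : ℕ => (starRingEnd ℂ) lam ^ n) atTop (𝓝 0) :=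
      tendsto_pow_atTop_nhds_zero_of_norm_lt_one (by simpa using hlam)
    simpa using this.mul_const t
  have hc : Tendsto (fun s : ℂ => ‖charFun μ s - charFun ν s‖) (𝓝 0) (𝓝 0) := by
    have hcont : Continuous (fun s : ℂ => ‖charFun μ s - charFun ν s‖) := by fun_prop
    simpa using hcont.tendsto 0
  have := ge_of_tendsto' (hc.comp hlim) hle'
  exact sub_eq_zero.1 (norm_le_zero_iff.1 this)

/-- The Fourier transform `ξ ↦ ∫ exp(2πi Re(z ξ̄)) dμ(z)` of a measure on `ℂ`. -/
def measureFourier (μ : Measure ℂ) (ξ : ℂ) : ℂ :=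
  ∫ z, Complex.exp (2 * Real.pi * Complex.I * ((z * (starRingEnd ℂ) ξ).re : ℝ)) ∂μ

/-- Fourier decay with exponent `γ`: for some `C > 0`, the Fourier transform of `μ` is bounded by
`C |ξ| ^ (-γ)` for all `ξ ≠ 0`. -/
def HasFourierDecay (μ : Measure ℂ) (γ : ℝ) : Prop :=
  ∃ C : ℝ, 0 < C ∧ ∀ ξ : ℂ, ξ ≠ 0 → ‖measureFourier μ ξ‖ ≤ C * ‖ξ‖ ^ (-γ)

/-- The region `H_{b₁, b₂, η}`. -/
def regionH (b₁ b₂ η : ℝ) : Set ℂ := {z | b₁ ≤ ‖z‖ ∧ ‖z‖ ≤ b₂ ∧ η < z.im}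

/-- `μ ∈ C^k`: the measure `μ` is absolutely continuous with respect to Lebesgue measure and its
Radon-Nikodym derivative has a `k` times continuously (real-)differentiable version. -/
def HasCkDensity (k : ℕ) (μ : Measure ℂ) : Prop :=
  μ ≪ volume ∧ ∃ f : ℂ → ℝ, ContDiff ℝ k f ∧
    (fun z => (μ.rnDeriv volume z).toReal) =ᵐ[volume] f

end

/-!
The proof is the Erdős–Kahane argument. Write `θ = lam⁻¹`. By self-similarity the Fourier transform
at `ξ` is dominated by a product of digit sums at `conj lam ^ n ξ`, and the `n`-th factor is at most
some `κ < 1`, depending only on the weights, unless `Re ((a j - a i) lam ^ n ξ̄)` is close to an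
integer (`exists_norm_digitCharFun_le`). Scaling so that `(a j - a i) ξ̄ = τ θ ^ N` with `|τ|` of
order `1`, these numbers are the terms of `x k = Re (τ θ ^ k)`, `k ≤ N`. Hence decay of order `|ξ| ^
(-γ)` follows once a definite proportion of the `x k`, `k ≤ N`, is far from the integers, for all
large `N` and all `τ` (`hasFourierDecay_of_proportion`).

The sequence `x` satisfies a linear recurrence of order two, whose coefficients `2 Re θ` and `|θ| ^
2` can be recovered from four consecutive terms by Cramer's rule. The determinant is `|τ θ ^ k| ^ 2
(Im θ) ^ 2`, so the next term is a Lipschitz function of these four terms, with a uniform constant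
(`re_geometric_stable`). If all terms involved are close to integers, the nearest integer to the
next term is therefore determined by the four previous ones; otherwise it has boundedly many
possible values. So the sequences with few terms far from the integers reach only `q ^ N` quadruples
of nearest integers at time `N`, with `q` as close to `1` as desired
(`exists_finset_round_of_farCount_lt`). Each quadruple confines `θ` to a set of diameter `O(b₁ ^
(-N))`, and covering the limsup set bounds its dimension (`dimH_limsup_le`). This controls the
exceptional `lam`.

When `θ` is fixed and three digits are used, two consecutive terms determine the next. The nearest
integers for the two sequences `Re (τ θ ^ k)` and `Re (t τ θ ^ k)` confine the ratio `t` to a set of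
diameter `O(|θ| ^ (-N))`, and the same counting applies.

For smoothness of the density, note that the measure for `lam` is a convolution of `m` rescaled
copies of the measure for `lam ^ m`, so decay with exponent `γ` for `lam ^ m` gives exponent `γ m`
for `lam` (`HasFourierDecay.of_pow`). When `|lam|` is close to `1`, a large `m` can be chosen with
`lam ^ (-m)` in a fixed annulus and away from the real axis (`exists_pow_mem_annulus`). There the
decay exponent `γ` is fixed outside a small exceptional set, and `γ m > k + 2` yields a `C^k`
density by Fourier inversion (`HasFourierDecay.hasCkDensity`).
-/

open scoped ENNReal NNReal FourierTransform SchwartzMap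

noncomputable section

/-! ### Counting almost deterministic sequences of states -/

/-- Consider states `h n ω` that move in time `n`, such that a good step is determined by the
current state and any other step has at most `M` outcomes. The weight `x` per bad step bounds the
number of states reached at time `n` after at most `b` bad steps. -/
theorem exists_finset_of_deterministic_steps {Ω σ : Type*} (h : ℕ → Ω → σ)
    (good : ℕ → Ω → Prop) (A M : ℕ) {x : ℝ} (hx0 : 0 < x) (hx1 : x ≤ 1)
    (h0 : ∃ T : Finset σ, T.card ≤ A ∧ ∀ ω, h 0 ω ∈ T)
    (hgood : ∀ n ω ω', h n ω = h n ω' → good n ω → good n ω' → h (n + 1) ω = h (n + 1) ω')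
    (hM : ∀ n s, ∃ F : Finset σ, F.card ≤ M ∧ ∀ ω, h n ω = s → h (n + 1) ω ∈ F) (n b : ℕ) :
    ∃ T : Finset σ, (T.card : ℝ) * x ^ b ≤ A * (1 + M * x) ^ n ∧
      ∀ ω, ({k ∈ (Finset.range n : Set ℕ) | ¬ good k ω}).ncard ≤ b → h n ω ∈ T := by
  classical
  induction n generalizing b with
  | zero =>
    obtain ⟨T, hT, hT'⟩ := h0
    refine ⟨T, ?_, fun ω _ => hT' ω⟩
    rw [pow_zero, mul_one]
    calc (T.card : ℝ) * x ^ b ≤ A * 1 := by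
          gcongr
          exact pow_le_one₀ hx0.le hx1
      _ = A := mul_one _
  | succ n ih =>
    obtain ⟨g, hg⟩ : ∃ g : σ → σ, ∀ ω, good n ω → h (n + 1) ω = g (h n ω) := by
      refine ⟨fun s => if H : ∃ ω, h n ω = s ∧ good n ω then h (n + 1) H.choose else s, ?_⟩
      intro ω hω
      have H : ∃ ω', h n ω' = h n ω ∧ good n ω' := ⟨ω, rfl, hω⟩
      simp only [H, dif_pos]
      exact hgood n _ _ H.choose_spec.1.symm hω H.choose_spec.2
    choose F hFc hF using hM n
    have hstep : ∀ ω, ({k ∈ (Finset.range (n + 1) : Set ℕ) | ¬ good k ω}).ncard =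
        ({k ∈ (Finset.range n : Set ℕ) | ¬ good k ω}).ncard + if good n ω then 0 else 1 := by
      intro ω
      have hfin : ({k ∈ (Finset.range n : Set ℕ) | ¬ good k ω}).Finite :=
        (Finset.range n).finite_toSet.subset (sep_subset _ _)
      split_ifs with hω
      · congr 1
        ext k
        simp only [Finset.coe_range, mem_Iio, mem_ofPred_eq, Order.lt_add_one_iff]
        refine ⟨fun hk => ⟨lt_of_le_of_ne hk.1 ?_, hk.2⟩, fun hk => ⟨hk.1.le, hk.2⟩⟩
        rintro rfl
        exact hk.2 hω
      · rw [← ncard_insert_of_notMem (a := n) (by simp) hfin]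
        congr 1
        ext k
        simp only [Finset.coe_range, mem_Iio, mem_ofPred_eq, Order.lt_add_one_iff, mem_insert_iff]
        constructor
        · rintro ⟨h1, h2⟩
          rcases h1.eq_or_lt with h3 | h3
          · exact Or.inl h3
          · exact Or.inr ⟨h3, h2⟩
        · rintro (rfl | h1)
          · exact ⟨le_rfl, hω⟩
          · exact ⟨h1.1.le, h1.2⟩
    have hpow : (0 : ℝ) ≤ A * (1 + M * x) ^ n := by positivity
    cases b with
    | zero =>
      obtain ⟨T, hT, hT'⟩ := ih 0
      refine ⟨T.image g, ?_, fun ω hω => ?_⟩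
      · calc ((T.image g).card : ℝ) * x ^ 0 ≤ T.card * x ^ 0 := by
              rw [pow_zero, mul_one, mul_one]
              exact_mod_cast Finset.card_image_le
          _ ≤ A * (1 + M * x) ^ n := hT
          _ ≤ A * (1 + M * x) ^ n * (1 + M * x) :=
              le_mul_of_one_le_right hpow (le_add_of_nonneg_right (by positivity))
          _ = _ := by ring
      · rw [hstep] at hω
        have hω' : good n ω := by
          by_contra hc
          simp [hc] at hω
        rw [hg ω hω']
        exact Finset.mem_image_of_mem _ (hT' ω (by simpa [hω'] using hω))
    | succ b =>
      obtain ⟨T, hT, hT'⟩ := ih (b + 1)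
      obtain ⟨S, hS, hS'⟩ := ih b
      refine ⟨T.image g ∪ S.biUnion F, ?_, fun ω hω => ?_⟩
      · have h1 : ((T.image g ∪ S.biUnion F).card : ℝ) ≤ T.card + S.card * M := by
          have : (T.image g ∪ S.biUnion F).card ≤ T.card + S.card * M :=
            (Finset.card_union_le _ _).trans (add_le_add Finset.card_image_le
              (Finset.card_biUnion_le_card_mul _ _ _ fun s _ => hFc s))
          exact_mod_cast this
        calc ((T.image g ∪ S.biUnion F).card : ℝ) * x ^ (b + 1)
            ≤ (T.card + S.card * M) * x ^ (b + 1) := by gcongr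
          _ = T.card * x ^ (b + 1) + M * x * (S.card * x ^ b) := by ring
          _ ≤ A * (1 + M * x) ^ n + M * x * (A * (1 + M * x) ^ n) := by gcongr
          _ = _ := by ring
      · rw [hstep] at hω
        by_cases hω' : good n ω
        · refine Finset.mem_union_left _ ?_
          rw [hg ω hω']
          exact Finset.mem_image_of_mem _ (hT' ω (by simpa [hω'] using hω))
        · refine Finset.mem_union_right _ (Finset.mem_biUnion.2 ⟨h n ω, hS' ω ?_, hF _ ω rfl⟩)
          simpa [hω'] using hω

/-- In the setting of `exists_finset_of_deterministic_steps`, if bad steps are rare enough then the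
number of states grows more slowly than any prescribed exponential `q ^ n`. -/
theorem exists_finset_of_rare_bad_steps {Ω σ : Type*} (h : ℕ → Ω → σ)
    (good : ℕ → Ω → Prop) (A M : ℕ) {q : ℝ} (hq : 1 < q)
    (h0 : ∃ T : Finset σ, T.card ≤ A ∧ ∀ ω, h 0 ω ∈ T)
    (hgood : ∀ n ω ω', h n ω = h n ω' → good n ω → good n ω' → h (n + 1) ω = h (n + 1) ω')
    (hM : ∀ n s, ∃ F : Finset σ, F.card ≤ M ∧ ∀ ω, h n ω = s → h (n + 1) ω ∈ F) :
    ∃ δ : ℝ, 0 < δ ∧ ∀ n : ℕ, ∃ T : Finset σ, (T.card : ℝ) ≤ A * q ^ n ∧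
      ∀ ω, (({k ∈ (Finset.range n : Set ℕ) | ¬ good k ω}).ncard : ℝ) ≤ δ * n → h n ω ∈ T := by
  set r := √q with hr
  have hr1 : 1 < r := Real.lt_sqrt_of_sq_lt (by simpa using hq)
  have hrr : r * r = q := Real.mul_self_sqrt (by linarith)
  set x : ℝ := min (1 / 2) ((r - 1) / (M + 1)) with hx
  have hx0 : 0 < x := lt_min (by norm_num) (div_pos (by linarith) (by positivity))
  have hx1 : x ≤ 1 / 2 := min_le_left _ _
  have hMx : 1 + M * x ≤ r := by
    have : x * (M + 1) ≤ r - 1 := by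
      rw [← le_div_iff₀ (by positivity)]
      exact min_le_right _ _
    nlinarith
  have hxinv : 1 < x⁻¹ := (one_lt_inv₀ hx0).2 (by linarith)
  refine ⟨Real.log r / Real.log x⁻¹, div_pos (Real.log_pos hr1) (Real.log_pos hxinv),
    fun n => ?_⟩
  set δ := Real.log r / Real.log x⁻¹
  have hδ : (x⁻¹) ^ δ = r := by
    rw [Real.rpow_def_of_pos (by positivity), mul_div_cancel₀ _ (Real.log_pos hxinv).ne',
      Real.exp_log (by linarith)]
  have hδ0 : 0 ≤ δ := (div_pos (Real.log_pos hr1) (Real.log_pos hxinv)).le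
  obtain ⟨T, hT, hT'⟩ := exists_finset_of_deterministic_steps h good A M hx0 (by linarith) h0
    hgood hM n ⌊δ * n⌋₊
  refine ⟨T, ?_, fun ω hω => hT' ω (Nat.le_floor hω)⟩
  have h1 : (x⁻¹) ^ ⌊δ * n⌋₊ ≤ r ^ n := by
    rw [← Real.rpow_natCast, ← hδ, ← Real.rpow_mul_natCast (by positivity)]
    exact Real.rpow_le_rpow_of_exponent_le hxinv.le (Nat.floor_le (by positivity))
  calc (T.card : ℝ) = T.card * x ^ ⌊δ * n⌋₊ * (x⁻¹) ^ ⌊δ * n⌋₊ := by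
        rw [mul_assoc, ← mul_pow, mul_inv_cancel₀ hx0.ne', one_pow, mul_one]
    _ ≤ A * (1 + M * x) ^ n * r ^ n := by gcongr
    _ ≤ A * r ^ n * r ^ n := by gcongr
    _ = A * q ^ n := by rw [mul_assoc, ← mul_pow, hrr]

/-- The number of indices `k < N` at which `x k` is at distance at least `ρ` from the integers. -/
def farCount (ρ : ℝ) (x : ℕ → ℝ) (N : ℕ) : ℕ :=
  ({k ∈ (Finset.range N : Set ℕ) | ρ ≤ |x k - round (x k)|}).ncard

theorem ncard_window_le (ρ : ℝ) (x : ℕ → ℝ) (s N : ℕ) :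
    ({k ∈ (Finset.range N : Set ℕ) |
      ¬ ∀ i ≤ s, |x (k + i) - round (x (k + i))| < ρ}).ncard ≤
      (s + 1) * (farCount ρ x N + s) := by
  classical
  have hsub : {k ∈ (Finset.range N : Set ℕ) |
      ¬ ∀ i ≤ s, |x (k + i) - round (x (k + i))| < ρ} ⊆
      ((Finset.range (s + 1)).biUnion fun i => (Finset.range N).filter fun k =>
        ρ ≤ |x (k + i) - round (x (k + i))| : Finset ℕ) := by
    rintro k ⟨hk, hk'⟩
    push Not at hk'
    obtain ⟨i, hi, hi'⟩ := hk'
    simp only [Finset.coe_biUnion, mem_iUnion]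
    exact ⟨i, by simpa using Nat.lt_succ_of_le hi, by simpa using ⟨by simpa using hk, hi'⟩⟩
  refine (ncard_le_ncard hsub (Finset.finite_toSet _)).trans ?_
  rw [ncard_coe_finset]
  refine (Finset.card_biUnion_le_card_mul _ _ (farCount ρ x N + s) fun i hi => ?_).trans
    (by rw [Finset.card_range])
  have hfc : farCount ρ x N =
      ((Finset.range N).filter fun k => ρ ≤ |x k - round (x k)|).card := by
    rw [← ncard_coe_finset, farCount]
    congr 1
    ext k
    simp
  have hsub' : ((Finset.range N).filter fun k => ρ ≤ |x (k + i) - round (x (k + i))|).image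
      (· + i) ⊆ ((Finset.range N).filter fun k => ρ ≤ |x k - round (x k)|) ∪
        Finset.Ico N (N + s) := by
    intro k hk
    simp only [Finset.mem_image, Finset.mem_filter, Finset.mem_range] at hk
    obtain ⟨j, ⟨hj, hj'⟩, rfl⟩ := hk
    have hi := Finset.mem_range.1 hi
    simp only [Finset.mem_union, Finset.mem_filter, Finset.mem_range, Finset.mem_Ico]
    by_cases hjN : j + i < N
    · exact Or.inl ⟨hjN, hj'⟩
    · exact Or.inr ⟨by omega, by omega⟩
  calc _ = _ := (Finset.card_image_of_injective _ (add_left_injective i)).symm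
    _ ≤ _ := Finset.card_le_card hsub'
    _ ≤ _ := Finset.card_union_le _ _
    _ = _ := by rw [hfc, Nat.card_Ico]; omega

/-- **The Erdős–Kahane argument.** Let real sequences `x · ω` be such that `s` consecutive terms
determine the next one, with Lipschitz dependence, uniformly in `ω`. If few terms of `x · ω` are far
from the integers, then few values are possible for the `s` nearest integers at time `N`. -/
theorem exists_finset_round_of_farCount_lt {Ω : Type*} (x : ℕ → Ω → ℝ) (s : ℕ) (C R : ℝ)
    (hC : 0 ≤ C)
    (hdet : ∀ n ω ω' d, d ≤ 1 → (∀ i < s, |x (n + i) ω - x (n + i) ω'| ≤ d) →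
      |x (n + s) ω - x (n + s) ω'| ≤ C * d)
    (hinit : ∀ ω, ∀ i < s, |x i ω| ≤ R) {q : ℝ} (hq : 1 < q) :
    ∃ ρ δ A : ℝ, ∃ N₀ : ℕ, 0 < ρ ∧ ρ ≤ 1 / 2 ∧ 0 < δ ∧ 0 < A ∧ ∀ N ≥ N₀,
      ∃ T : Finset (Fin s → ℤ), (T.card : ℝ) ≤ A * q ^ N ∧
        ∀ ω, (farCount ρ (fun k => x k ω) N : ℝ) < δ * N →
          (fun i : Fin s => round (x (N + i) ω)) ∈ T := by
  classical
  set ρ : ℝ := 1 / (4 * (C + 1)) with hρ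
  have hρ0 : 0 < ρ := by positivity
  have hρC : (C + 1) * ρ = 1 / 4 := by
    rw [hρ]; field_simp
  have hρ2 : ρ ≤ 1 / 4 := by nlinarith
  set h : ℕ → Ω → (Fin s → ℤ) := fun n ω i => round (x (n + i) ω) with hh
  set good : ℕ → Ω → Prop := fun n ω => ∀ i ≤ s, |x (n + i) ω - round (x (n + i) ω)| < ρ
  let nxt : (Fin s → ℤ) → ℤ → (Fin s → ℤ) :=
    fun f v i => if hi : (i : ℕ) + 1 < s then f ⟨i + 1, hi⟩ else v
  have hnxt : ∀ n ω, h (n + 1) ω = nxt (h n ω) (round (x (n + s) ω)) := by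
    intro n ω
    funext i
    simp only [hh, nxt]
    split_ifs with hi
    · rw [show n + 1 + (i : ℕ) = n + (i + 1) by ring]
    · have : n + 1 + (i : ℕ) = n + s := by
        have := i.2
        omega
      rw [this]
  have hdiff : ∀ n ω ω' d, (∀ i < s, |x (n + i) ω - round (x (n + i) ω)| ≤ d) →
      (∀ i < s, |x (n + i) ω' - round (x (n + i) ω')| ≤ d) → h n ω = h n ω' → 2 * d ≤ 1 →
      |x (n + s) ω - x (n + s) ω'| ≤ C * (2 * d) := by
    intro n ω ω' d h1 h2 h3 hd
    refine hdet n ω ω' (2 * d) hd fun i hi => ?_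
    have e : round (x (n + i) ω) = round (x (n + i) ω') := congrFun h3 ⟨i, hi⟩
    have h1 := h1 i hi
    have h2 := h2 i hi
    rw [e] at h1
    rw [abs_le] at *
    constructor <;> linarith [h1.1, h1.2, h2.1, h2.2]
  have hgood : ∀ n ω ω', h n ω = h n ω' → good n ω → good n ω' → h (n + 1) ω = h (n + 1) ω' := by
    intro n ω ω' he hg hg'
    rw [hnxt, hnxt, he]
    congr 1
    have h1 := hdiff n ω ω' ρ (fun i hi => (hg i hi.le).le) (fun i hi => (hg' i hi.le).le) he
      (by linarith)
    have h2 := hg s le_rfl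
    have h3 := hg' s le_rfl
    have h4 : |((round (x (n + s) ω) - round (x (n + s) ω') : ℤ) : ℝ)| < 1 := by
      push_cast
      rw [abs_le] at h1
      rw [abs_lt] at *
      constructor <;> nlinarith [h1.1, h1.2, h2.1, h2.2, h3.1, h3.2]
    have h5 : |round (x (n + s) ω) - round (x (n + s) ω')| < 1 := by exact_mod_cast h4
    exact sub_eq_zero.1 (Int.abs_lt_one_iff.1 h5)
  set B : ℤ := ⌈C + 1⌉ with hB
  set M : ℕ := (2 * B + 1).toNat
  have hM : ∀ n f, ∃ F : Finset (Fin s → ℤ), F.card ≤ M ∧ ∀ ω, h n ω = f → h (n + 1) ω ∈ F := by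
    intro n f
    by_cases H : ∃ ω, h n ω = f
    · obtain ⟨ω, rfl⟩ := H
      refine ⟨(Finset.Icc (round (x (n + s) ω) - B) (round (x (n + s) ω) + B)).image
        (nxt (h n ω)), Finset.card_image_le.trans ?_, fun ω' h' => ?_⟩
      · rw [Int.card_Icc]
        exact le_of_eq (congrArg _ (by ring))
      · rw [hnxt, h']
        refine Finset.mem_image_of_mem _ ?_
        have h1 := hdiff n ω ω' (1 / 2) (fun i _ => abs_sub_round _) (fun i _ => abs_sub_round _)
          h'.symm (by norm_num)
        have h2 := abs_sub_round (x (n + s) ω)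
        have h3 := abs_sub_round (x (n + s) ω')
        have h4 := Int.le_ceil (C + 1)
        rw [abs_le] at h1 h2 h3
        rw [Finset.mem_Icc]
        constructor
        · have : (round (x (n + s) ω) : ℝ) - B ≤ round (x (n + s) ω') := by
            linarith [h1.1, h1.2, h2.1, h2.2, h3.1, h3.2]
          exact_mod_cast this
        · have : (round (x (n + s) ω') : ℝ) ≤ round (x (n + s) ω) + B := by
            linarith [h1.1, h1.2, h2.1, h2.2, h3.1, h3.2]
          exact_mod_cast this
    · exact ⟨∅, by simp, fun ω hω => (H ⟨ω, hω⟩).elim⟩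
  set T0 : Finset (Fin s → ℤ) :=
    Fintype.piFinset fun _ => Finset.Icc (-⌈R + 1⌉) ⌈R + 1⌉ with hT0
  obtain ⟨δ, hδ, H⟩ := exists_finset_of_rare_bad_steps h good (T0.card + 1) M hq
    ⟨T0, Nat.le_succ _, fun ω => by
      rw [hT0, Fintype.mem_piFinset]
      intro i
      have h1 := hinit ω i i.2
      have h2 := abs_sub_round (x i ω)
      have h3 := Int.le_ceil (R + 1)
      have e : h 0 ω i = round (x i ω) := by simp [hh]
      rw [e, Finset.mem_Icc]
      rw [abs_le] at h1 h2
      constructor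
      · have : (-⌈R + 1⌉ : ℝ) ≤ round (x i ω) := by linarith [h1.1, h1.2, h2.1, h2.2]
        exact_mod_cast this
      · have : (round (x i ω) : ℝ) ≤ ⌈R + 1⌉ := by linarith [h1.1, h1.2, h2.1, h2.2]
        exact_mod_cast this⟩ hgood hM
  -- A term far from the integers spoils at most `s + 1` steps, and the `s` terms after time `N`
  -- are counted as far.
  refine ⟨ρ, δ / (2 * (s + 1)), (T0.card + 1 : ℕ), ⌈2 * (s + 1) * s / δ⌉₊, hρ0, by linarith,
    by positivity, by positivity, fun N hN => ?_⟩
  obtain ⟨T, hT, hT'⟩ := H N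
  refine ⟨T, hT, fun ω hω => hT' ω ?_⟩
  have h1 : ((({k ∈ (Finset.range N : Set ℕ) | ¬ good k ω}).ncard : ℕ) : ℝ) ≤
      (s + 1) * (farCount ρ (fun k => x k ω) N + s) := by
    exact_mod_cast ncard_window_le ρ (fun k => x k ω) s N
  have h2 : 2 * (s + 1) * s ≤ δ * N := by
    have := (Nat.le_ceil _).trans (Nat.cast_le (α := ℝ).2 hN)
    rwa [div_le_iff₀ hδ, mul_comm (N : ℝ)] at this
  refine h1.trans ?_
  have h3 : (s + 1 : ℝ) * farCount ρ (fun k => x k ω) N ≤ δ * N / 2 := by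
    calc (s + 1 : ℝ) * farCount ρ (fun k => x k ω) N ≤ (s + 1) * (δ / (2 * (s + 1)) * N) := by
          gcongr
      _ = δ * N / 2 := by field_simp
  nlinarith

/-! ### Dimension of limsup sets -/

/-- If for all large `N` the set `E N` is covered by `O(q ^ N)` sets of diameter `O(r ^ N)`, and
`q * r ^ s < 1`, then the set of points in infinitely many `E N` has dimension at most `s`. -/
theorem dimH_limsup_le {X σ : Type*} [MetricSpace X] (E : ℕ → Set X) (U : ℕ → σ → Set X)
    {A q C r : ℝ} {s : ℝ≥0} {N₀ : ℕ} (hA : 0 < A) (hq : 0 < q) (hC : 0 < C) (hr0 : 0 < r)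
    (hr1 : r < 1)
    (hs : q * r ^ (s : ℝ) < 1)
    (hcov : ∀ N ≥ N₀, ∃ T : Finset σ, (T.card : ℝ) ≤ A * q ^ N ∧ E N ⊆ ⋃ i ∈ T, U N i)
    (hdiam : ∀ N ≥ N₀, ∀ i, ∀ x ∈ U N i, ∀ y ∈ U N i, dist x y ≤ C * r ^ N) :
    dimH {x | ∃ᶠ N in atTop, x ∈ E N} ≤ s := by
  borelize X
  set S := {x | ∃ᶠ N in atTop, x ∈ E N}
  choose T hT hET using fun N : ℕ => hcov (N₀ + N) (Nat.le_add_right _ _)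
  have hed : ∀ N i, Metric.ediam (U (N₀ + N) i) ≤ ENNReal.ofReal (C * r ^ (N₀ + N)) := by
    intro N i
    refine Metric.ediam_le fun x hx y hy => ?_
    rw [edist_dist]
    exact ENNReal.ofReal_le_ofReal (hdiam _ (Nat.le_add_right _ _) i x hx y hy)
  have hzero : μH[(s : ℝ)] S ≤ 0 := by
    set g : ℕ → ℝ := fun N => A * C ^ (s : ℝ) * (q * r ^ (s : ℝ)) ^ (N₀ + N) with hg
    have hqr : 0 < q * r ^ (s : ℝ) := by positivity
    have hgs : Summable g := by
      have : Summable fun N : ℕ => (q * r ^ (s : ℝ)) ^ (N + N₀) :=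
        (summable_nat_add_iff N₀).2 (summable_geometric_of_lt_one hqr.le hs)
      simpa [hg, add_comm] using this.mul_left (A * C ^ (s : ℝ))
    have hg0 : ∀ N, 0 ≤ g N := fun N => by positivity
    have hterm : ∀ N, ∑ i ∈ T N, Metric.ediam (U (N₀ + N) i) ^ (s : ℝ) ≤ ENNReal.ofReal (g N) := by
      intro N
      calc ∑ i ∈ T N, Metric.ediam (U (N₀ + N) i) ^ (s : ℝ)
          ≤ ∑ i ∈ T N, ENNReal.ofReal ((C * r ^ (N₀ + N)) ^ (s : ℝ)) := by
            refine Finset.sum_le_sum fun i _ => ?_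
            rw [← ENNReal.ofReal_rpow_of_nonneg (by positivity) (NNReal.coe_nonneg s)]
            exact ENNReal.rpow_le_rpow (hed N i) (NNReal.coe_nonneg s)
        _ = ENNReal.ofReal ((T N).card * (C * r ^ (N₀ + N)) ^ (s : ℝ)) := by
            rw [Finset.sum_const, nsmul_eq_mul, ENNReal.ofReal_mul (by positivity),
              ENNReal.ofReal_natCast]
        _ ≤ ENNReal.ofReal (g N) := by
            refine ENNReal.ofReal_le_ofReal ?_
            calc ((T N).card : ℝ) * (C * r ^ (N₀ + N)) ^ (s : ℝ)
                ≤ A * q ^ (N₀ + N) * (C * r ^ (N₀ + N)) ^ (s : ℝ) := by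
                  gcongr
                  exact hT N
              _ = g N := by
                  rw [hg, Real.mul_rpow hC.le (by positivity), ← Real.rpow_natCast r,
                    ← Real.rpow_mul hr0.le, mul_comm ((N₀ + N : ℕ) : ℝ) (s : ℝ),
                    Real.rpow_mul hr0.le, Real.rpow_natCast]
                  ring
    -- The covers of `S` by all the pieces of level at least `n`.
    have key := Measure.mkMetric_le_liminf_tsum (β := ℕ) (ι := fun n => Σ N : ℕ, T (n + N)) S
      (l := atTop) (fun n => ENNReal.ofReal (C * r ^ (N₀ + n))) ?_
      (fun n i => U (N₀ + (n + i.1)) i.2) ?_ ?_ (fun d => d ^ (s : ℝ))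
    · have hlim : Tendsto (fun n => ∑' N, ENNReal.ofReal (g (N + n))) atTop (𝓝 0) := by
        refine ENNReal.tendsto_sum_nat_add (fun N => ENNReal.ofReal (g N)) ?_
        exact hgs.tsum_ofReal_ne_top
      rw [← hlim.liminf_eq]
      refine key.trans (liminf_le_liminf (Eventually.of_forall fun n => ?_))
      rw [ENNReal.tsum_sigma']
      refine ENNReal.tsum_le_tsum fun N => ?_
      rw [tsum_fintype, add_comm N n,
        Finset.sum_coe_sort (T (n + N)) fun i => Metric.ediam (U (N₀ + (n + N)) i) ^ (s : ℝ)]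
      exact hterm _
    · have h1 : Tendsto (fun n : ℕ => C * r ^ (N₀ + n)) atTop (𝓝 (C * 0)) := by
        refine Tendsto.const_mul _ ?_
        have := (tendsto_add_atTop_iff_nat N₀).2 (tendsto_pow_atTop_nhds_zero_of_lt_one hr0.le hr1)
        simpa [add_comm] using this
      simpa using ENNReal.tendsto_ofReal h1
    · refine Eventually.of_forall fun n i => (hed _ _).trans (ENNReal.ofReal_le_ofReal ?_)
      gcongr C * ?_
      exact pow_le_pow_of_le_one hr0.le hr1.le (by omega)
    · refine Eventually.of_forall fun n x hx => ?_
      obtain ⟨N, hN, hxN⟩ := (frequently_atTop.1 hx) (N₀ + n)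
      obtain ⟨m, rfl⟩ := Nat.exists_eq_add_of_le hN
      rw [add_assoc] at hxN
      obtain ⟨i, hi, hxi⟩ := mem_iUnion₂.1 (hET _ hxN)
      exact mem_iUnion.2 ⟨⟨m, i, hi⟩, hxi⟩
  exact dimH_le_of_hausdorffMeasure_ne_top (by rw [nonpos_iff_eq_zero.1 hzero]; simp)

/-- For `q` close enough to `1` the condition `q * r ^ s < 1` of `dimH_limsup_le` holds, even with
`q ^ 2` in place of `q`. -/
theorem exists_one_lt_sq_mul_rpow_lt_one {r s : ℝ} (hr0 : 0 < r) (hr1 : r < 1) (hs : 0 < s) :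
    ∃ q : ℝ, 1 < q ∧ q * r ^ s < 1 ∧ q ^ 2 * r ^ s < 1 := by
  have h1 : r ^ s < 1 := Real.rpow_lt_one hr0.le hr1 hs
  have h2 : ContinuousAt (fun q : ℝ => q ^ 2 * r ^ s) 1 := by fun_prop
  have h3 : ∀ᶠ q in 𝓝 (1 : ℝ), q ^ 2 * r ^ s < 1 := h2.eventually_lt_const (by simpa using h1)
  obtain ⟨q, hq, hq'⟩ := (h3.filter_mono nhdsWithin_le_nhds |>.and
    (self_mem_nhdsWithin : Ioi (1 : ℝ) ∈ 𝓝[>] 1)).exists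
  have hq'' : 1 < q := hq'
  refine ⟨q, hq', lt_of_le_of_lt ?_ hq, hq⟩
  gcongr
  nlinarith

/-! ### Real parts of complex geometric progressions -/

theorem Complex.re_mul_sq_eq (z θ : ℂ) :
    (z * θ ^ 2).re = 2 * θ.re * (z * θ).re - ‖θ‖ ^ 2 * z.re := by
  rw [← Complex.normSq_eq_norm_sq, Complex.normSq_apply, pow_two]
  simp only [Complex.mul_re, Complex.mul_im]
  ring

theorem Complex.re_mul_pow_add_two (z θ : ℂ) (i : ℕ) :
    (z * θ ^ (i + 2)).re = 2 * θ.re * (z * θ ^ (i + 1)).re - ‖θ‖ ^ 2 * (z * θ ^ i).re := by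
  have := Complex.re_mul_sq_eq (z * θ ^ i) θ
  rwa [mul_assoc z, mul_assoc z, ← pow_add, ← pow_succ] at this

theorem Complex.re_mul_sq_sub_eq (z θ : ℂ) :
    (z * θ).re ^ 2 - z.re * (z * θ ^ 2).re = ‖z‖ ^ 2 * θ.im ^ 2 := by
  rw [← Complex.normSq_eq_norm_sq, Complex.normSq_apply, pow_two θ]
  simp only [Complex.mul_re, Complex.mul_im]
  ring

theorem Complex.abs_re_mul_pow_le {z θ : ℂ} {b : ℝ} (hθ : ‖θ‖ ≤ b) (i : ℕ) :
    |(z * θ ^ i).re| ≤ ‖z‖ * b ^ i := by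
  refine (Complex.abs_re_le_norm _).trans ?_
  rw [norm_mul, norm_pow]
  gcongr

/-- Stability of the coefficients of a recurrence `x₂ = A x₁ - B x₀`, recovered by Cramer's rule
from four consecutive terms, when the discriminant `x₁² - x₀ x₂` is of the order `Z²` and the terms
are of the order `Z`. -/
theorem recurrence_coeff_stable {A B A' B' x₀ x₁ x₂ x₃ y₀ y₁ y₂ y₃ d b Z η : ℝ} (hb : 0 ≤ b)
    (hZ : 0 < Z) (hη : 0 < η) (hd : 0 ≤ d)
    (hx₂ : x₂ = A * x₁ - B * x₀) (hx₃ : x₃ = A * x₂ - B * x₁)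
    (hy₂ : y₂ = A' * y₁ - B' * y₀) (hy₃ : y₃ = A' * y₂ - B' * y₁)
    (h₀ : |x₀ - y₀| ≤ d) (h₁ : |x₁ - y₁| ≤ d) (h₂ : |x₂ - y₂| ≤ d) (h₃ : |x₃ - y₃| ≤ d)
    (hA' : |A'| ≤ 2 * b) (hB' : |B'| ≤ b ^ 2)
    (hx₀Z : |x₀| ≤ Z) (hx₁Z : |x₁| ≤ Z * b) (hx₂Z : |x₂| ≤ Z * b ^ 2)
    (hD : Z ^ 2 * η ^ 2 ≤ x₁ ^ 2 - x₀ * x₂) :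
    |A - A'| * Z ≤ (1 + b) ^ 4 / η ^ 2 * d ∧ |B - B'| * Z ≤ (1 + b) ^ 4 / η ^ 2 * d := by
  have hres : ∀ e f g : ℝ, |e| ≤ d → |f| ≤ d → |g| ≤ d →
      |e - A' * f + B' * g| ≤ (1 + b) ^ 2 * d := by
    intro e f g he hf hg
    calc |e - A' * f + B' * g| ≤ |e| + |A'| * |f| + |B'| * |g| := by
          rw [← abs_mul, ← abs_mul]
          exact (abs_add_le _ _).trans (add_le_add (abs_sub _ _) le_rfl)
      _ ≤ d + 2 * b * d + b ^ 2 * d := by gcongr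
      _ = (1 + b) ^ 2 * d := by ring
  set u := (x₂ - y₂) - A' * (x₁ - y₁) + B' * (x₀ - y₀) with hu
  set v := (x₃ - y₃) - A' * (x₂ - y₂) + B' * (x₁ - y₁) with hv
  have hu' : |u| ≤ (1 + b) ^ 2 * d := hres _ _ _ h₂ h₁ h₀
  have hv' : |v| ≤ (1 + b) ^ 2 * d := hres _ _ _ h₃ h₂ h₁
  have hue : u = (A - A') * x₁ - (B - B') * x₀ := by
    rw [hu]; linear_combination hx₂ - hy₂
  have hve : v = (A - A') * x₂ - (B - B') * x₁ := by
    rw [hv]; linear_combination hx₃ - hy₃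
  have hAe : (A - A') * (x₁ ^ 2 - x₀ * x₂) = u * x₁ - v * x₀ := by rw [hue, hve]; ring
  have hBe : (B - B') * (x₁ ^ 2 - x₀ * x₂) = u * x₂ - v * x₁ := by rw [hue, hve]; ring
  have hDpos : 0 < x₁ ^ 2 - x₀ * x₂ := lt_of_lt_of_le (by positivity) hD
  have hfin : ∀ w p q : ℝ, w * (x₁ ^ 2 - x₀ * x₂) = u * p - v * q →
      |p| + |q| ≤ Z * (1 + b) ^ 2 → |w| * Z ≤ (1 + b) ^ 4 / η ^ 2 * d := by
    intro w p q hw hpq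
    have h1 : |w| * (Z ^ 2 * η ^ 2) ≤ Z * (1 + b) ^ 4 * d := by
      calc |w| * (Z ^ 2 * η ^ 2) ≤ |w| * (x₁ ^ 2 - x₀ * x₂) := by gcongr
        _ = |u * p - v * q| := by rw [← hw, abs_mul, abs_of_pos hDpos]
        _ ≤ |u| * |p| + |v| * |q| := by
            rw [← abs_mul, ← abs_mul]
            exact abs_sub _ _
        _ ≤ (1 + b) ^ 2 * d * |p| + (1 + b) ^ 2 * d * |q| := by gcongr
        _ = (1 + b) ^ 2 * d * (|p| + |q|) := by ring
        _ ≤ (1 + b) ^ 2 * d * (Z * (1 + b) ^ 2) := by gcongr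
        _ = Z * (1 + b) ^ 4 * d := by ring
    rw [div_mul_eq_mul_div, le_div_iff₀ (by positivity)]
    have h2 : Z * (|w| * Z * η ^ 2) ≤ Z * ((1 + b) ^ 4 * d) := by linarith
    exact le_of_mul_le_mul_left h2 hZ
  refine ⟨hfin _ _ _ hAe ?_, hfin _ _ _ hBe ?_⟩
  · nlinarith [mul_nonneg hZ.le hb, mul_nonneg hZ.le (sq_nonneg b)]
  · nlinarith [mul_nonneg hZ.le hb, mul_nonneg hZ.le (sq_nonneg b)]

/-- Four consecutive terms of `Re (z θ ^ i)` determine, in a stable way, the trace `2 Re θ`, the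
norm `|θ| ^ 2` and the next term. -/
theorem re_geometric_stable {z θ z' θ' : ℂ} {b η d : ℝ} (hη : 0 < η) (hd : 0 ≤ d)
    (hz : z ≠ 0) (hθ : ‖θ‖ ≤ b) (hθ' : ‖θ'‖ ≤ b) (hθη : η ≤ θ.im)
    (h : ∀ i < 4, |(z * θ ^ i).re - (z' * θ' ^ i).re| ≤ d) :
    |2 * θ.re - 2 * θ'.re| * ‖z‖ ≤ (1 + b) ^ 4 / η ^ 2 * d ∧
    |‖θ‖ ^ 2 - ‖θ'‖ ^ 2| * ‖z‖ ≤ (1 + b) ^ 4 / η ^ 2 * d ∧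
    |(z * θ ^ 4).re - (z' * θ' ^ 4).re| ≤
      (2 * (1 + b) ^ 7 / η ^ 2 + (1 + b) ^ 2) * d := by
  have hb : 0 ≤ b := (norm_nonneg _).trans hθ
  have hrec := Complex.re_mul_pow_add_two
  have hA' : |2 * θ'.re| ≤ 2 * b := by
    rw [abs_mul, abs_two]
    have := (Complex.abs_re_le_norm θ').trans hθ'
    linarith
  have hB' : |‖θ'‖ ^ 2| ≤ b ^ 2 := by
    rw [abs_of_nonneg (by positivity)]
    gcongr
  have hD : ‖z‖ ^ 2 * η ^ 2 ≤ (z * θ ^ 1).re ^ 2 - (z * θ ^ 0).re * (z * θ ^ 2).re := by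
    rw [pow_one, pow_zero, mul_one, Complex.re_mul_sq_sub_eq]
    gcongr
  have hx := fun i => Complex.abs_re_mul_pow_le (z := z) hθ i
  obtain ⟨h1, h2⟩ := recurrence_coeff_stable hb (norm_pos_iff.2 hz) hη hd (hrec z θ 0) (hrec z θ 1)
    (hrec z' θ' 0) (hrec z' θ' 1) (h 0 (by norm_num)) (h 1 (by norm_num)) (h 2 (by norm_num))
    (h 3 (by norm_num)) hA' hB' (by simpa using hx 0) (by simpa using hx 1) (hx 2) hD
  refine ⟨h1, h2, ?_⟩
  set K := (1 + b) ^ 4 / η ^ 2 with hK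
  have hK0 : 0 ≤ K := by positivity
  have e : (z * θ ^ 4).re - (z' * θ' ^ 4).re =
      (2 * θ.re - 2 * θ'.re) * (z * θ ^ 3).re - (‖θ‖ ^ 2 - ‖θ'‖ ^ 2) * (z * θ ^ 2).re +
      (2 * θ'.re * ((z * θ ^ 3).re - (z' * θ' ^ 3).re) -
        ‖θ'‖ ^ 2 * ((z * θ ^ 2).re - (z' * θ' ^ 2).re)) := by
    rw [hrec z θ 2, hrec z' θ' 2]; ring
  rw [e]
  calc _ ≤ |2 * θ.re - 2 * θ'.re| * |(z * θ ^ 3).re| + |‖θ‖ ^ 2 - ‖θ'‖ ^ 2| * |(z * θ ^ 2).re| +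
        (|2 * θ'.re| * |(z * θ ^ 3).re - (z' * θ' ^ 3).re| +
          |‖θ'‖ ^ 2| * |(z * θ ^ 2).re - (z' * θ' ^ 2).re|) := by
        simp only [← abs_mul]
        exact (abs_add_le _ _).trans (add_le_add (abs_sub _ _) (abs_sub _ _))
    _ ≤ |2 * θ.re - 2 * θ'.re| * (‖z‖ * b ^ 3) + |‖θ‖ ^ 2 - ‖θ'‖ ^ 2| * (‖z‖ * b ^ 2) +
        (2 * b * d + b ^ 2 * d) := by
        gcongr
        · exact hx 3
        · exact hx 2
        · exact h 3 (by norm_num)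
        · exact h 2 (by norm_num)
    _ = (|2 * θ.re - 2 * θ'.re| * ‖z‖) * b ^ 3 + (|‖θ‖ ^ 2 - ‖θ'‖ ^ 2| * ‖z‖) * b ^ 2 +
        (2 * b * d + b ^ 2 * d) := by ring
    _ ≤ K * d * b ^ 3 + K * d * b ^ 2 + (2 * b * d + b ^ 2 * d) := by gcongr
    _ ≤ K * d * (1 + b) ^ 3 + K * d * (1 + b) ^ 3 + (1 + b) ^ 2 * d := by
        have e1 : b ^ 3 ≤ (1 + b) ^ 3 := by gcongr; linarith
        have e2 : b ^ 2 ≤ (1 + b) ^ 3 := by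
          nlinarith [mul_nonneg hb (sq_nonneg b), sq_nonneg b]
        have e3 : 2 * b * d + b ^ 2 * d ≤ (1 + b) ^ 2 * d := by
          have : (2 * b + b ^ 2) * d ≤ (1 + b) ^ 2 * d := by
            gcongr
            nlinarith
          linarith
        gcongr
    _ = _ := by rw [hK]; ring

theorem Complex.norm_le_of_abs_re_le {w θ : ℂ} {b d : ℝ} (hd : 0 ≤ d) (hθ : ‖θ‖ ≤ b)
    (hθi : θ.im ≠ 0) (h₀ : |w.re| ≤ d) (h₁ : |(w * θ).re| ≤ d) :
    ‖w‖ ≤ (1 + (1 + b) / |θ.im|) * d := by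
  have hb : 0 ≤ b := (norm_nonneg _).trans hθ
  have h2 : |w.im| * |θ.im| ≤ (1 + b) * d := by
    have e : w.im * θ.im = w.re * θ.re - (w * θ).re := by rw [Complex.mul_re]; ring
    rw [← abs_mul, e]
    calc |w.re * θ.re - (w * θ).re| ≤ |w.re| * |θ.re| + |(w * θ).re| := by
          rw [← abs_mul]
          exact abs_sub _ _
      _ ≤ d * b + d := by
          gcongr
          exact (Complex.abs_re_le_norm _).trans hθ
      _ = (1 + b) * d := by ring
  have h3 : |w.im| ≤ (1 + b) / |θ.im| * d := by
    rw [div_mul_eq_mul_div, le_div_iff₀ (abs_pos.2 hθi)]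
    exact h2
  calc ‖w‖ ≤ |w.re| + |w.im| := Complex.norm_le_abs_re_add_abs_im w
    _ ≤ d + (1 + b) / |θ.im| * d := add_le_add h₀ h3
    _ = _ := by ring

theorem abs_sub_le_one_of_round_eq {x y : ℝ} (h : round x = round y) : |x - y| ≤ 1 := by
  have h1 := abs_sub_round x
  have h2 := abs_sub_round y
  rw [h] at h1
  rw [abs_le] at *
  constructor <;> linarith [h1.1, h1.2, h2.1, h2.2]

/-! ### Exceptional parameters -/

/-- For all `θ` in a compact part of the upper half plane outside a set of small dimension, each
sequence `Re (τ θ ^ k)` has a definite proportion of terms far from the integers. -/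
theorem exists_exceptional_upper {s : ℝ≥0} (hs : 0 < s) {b₁ b₂ η : ℝ} (hb₁ : 1 < b₁)
    (hb : b₁ < b₂) (hη : 0 < η) :
    ∃ (E : Set ℂ) (ρ δ : ℝ), 0 < ρ ∧ ρ ≤ 1 / 2 ∧ 0 < δ ∧ dimH E ≤ s ∧
      ∀ θ ∈ regionH b₁ b₂ η \ E, ∃ N₀ : ℕ, ∀ N ≥ N₀, ∀ τ : ℂ, 1 ≤ ‖τ‖ → ‖τ‖ ≤ b₂ →
        δ * N ≤ farCount ρ (fun k => (τ * θ ^ k).re) N := by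
  have hr1 : b₁⁻¹ < 1 := inv_lt_one_of_one_lt₀ hb₁
  have hr0 : 0 < b₁⁻¹ := inv_pos.2 (by linarith)
  obtain ⟨q, hq1, hq, -⟩ := exists_one_lt_sq_mul_rpow_lt_one hr0 hr1 (NNReal.coe_pos.2 hs)
  let Ω := {ω : ℂ × ℂ // ω.1 ∈ regionH b₁ b₂ η ∧ 1 ≤ ‖ω.2‖ ∧ ‖ω.2‖ ≤ b₂}
  set x : ℕ → Ω → ℝ := fun n ω => (ω.1.2 * ω.1.1 ^ n).re with hx
  have hshift : ∀ (n i : ℕ) (ω : Ω), x (n + i) ω = (ω.1.2 * ω.1.1 ^ n * ω.1.1 ^ i).re := by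
    intro n i ω
    simp only [hx, pow_add, mul_assoc]
  have hz : ∀ (n : ℕ) (ω : Ω), b₁ ^ n ≤ ‖ω.1.2 * ω.1.1 ^ n‖ := by
    intro n ω
    rw [norm_mul, norm_pow]
    calc b₁ ^ n ≤ ‖ω.1.1‖ ^ n := by
          gcongr
          exact ω.2.1.1
      _ ≤ _ := le_mul_of_one_le_left (by positivity) ω.2.2.1
  have hz0 : ∀ (n : ℕ) (ω : Ω), ω.1.2 * ω.1.1 ^ n ≠ 0 := fun n ω =>
    norm_pos_iff.1 (lt_of_lt_of_le (by positivity) (hz n ω))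
  have hb0 : 1 < b₂ := hb₁.trans hb
  obtain ⟨ρ, δ, A, N₀, hρ, hρ', hδ, hA, H⟩ := exists_finset_round_of_farCount_lt x 4
    (2 * (1 + b₂) ^ 7 / η ^ 2 + (1 + b₂) ^ 2) (b₂ * b₂ ^ 3) (by positivity) (by
      intro n ω ω' d _ h
      have hd : 0 ≤ d := (abs_nonneg _).trans (h 0 (by norm_num))
      simp only [hshift] at h ⊢
      exact (re_geometric_stable hη hd (hz0 n ω) ω.2.1.2.1 ω'.2.1.2.1 ω.2.1.2.2.le h).2.2) (by
      intro ω i hi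
      refine (Complex.abs_re_mul_pow_le ω.2.1.2.1 i).trans ?_
      have h1 : b₂ ^ i ≤ b₂ ^ 3 := pow_le_pow_right₀ hb0.le (by omega)
      have h2 := ω.2.2.2
      gcongr) hq1
  set F : ℕ → Set ℂ := fun N =>
    {θ | ∃ ω : Ω, ω.1.1 = θ ∧ (farCount ρ (fun k => x k ω) N : ℝ) < δ * N}
  set U : ℕ → (Fin 4 → ℤ) → Set ℂ := fun N f =>
    {θ | ∃ ω : Ω, ω.1.1 = θ ∧ (fun i : Fin 4 => round (x (N + i) ω)) = f}
  set K : ℝ := (1 + b₂) ^ 4 / η ^ 2 with hK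
  have hK0 : 0 < K := by positivity
  refine ⟨{θ | ∃ᶠ N in atTop, θ ∈ F N}, ρ, δ, hρ, hρ', hδ,
    dimH_limsup_le F U (C := K * (1 + (1 + b₂) / η)) hA (by linarith) (by positivity) hr0 hr1 hq
      (N₀ := N₀) ?_ ?_, ?_⟩
  · intro N hN
    obtain ⟨T, hT, hT'⟩ := H N hN
    refine ⟨T, hT, ?_⟩
    rintro θ ⟨ω, rfl, hω⟩
    exact mem_iUnion₂.2 ⟨_, hT' ω hω, ω, rfl, rfl⟩
  · rintro N - f _ ⟨ω, rfl, hω⟩ _ ⟨ω', rfl, hω'⟩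
    have h := re_geometric_stable (d := 1) hη zero_le_one (hz0 N ω) ω.2.1.2.1 ω'.2.1.2.1
      ω.2.1.2.2.le (z' := ω'.1.2 * ω'.1.1 ^ N) (fun i hi => by
        rw [← hshift, ← hshift]
        exact abs_sub_le_one_of_round_eq (congrFun (hω.trans hω'.symm) ⟨i, hi⟩))
    rw [← hK, mul_one] at h
    have hzN := hz N ω
    have hpos : 0 < b₁ ^ N := by positivity
    have hscale : ∀ w : ℝ, |w| * ‖ω.1.2 * ω.1.1 ^ N‖ ≤ K → |w| ≤ K * b₁⁻¹ ^ N := by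
      intro w hw
      rw [inv_pow, ← div_eq_mul_inv, le_div_iff₀ hpos]
      exact (mul_le_mul_of_nonneg_left hzN (abs_nonneg _)).trans hw
    have hA1 := hscale _ h.1
    have hB1 := hscale _ h.2.1
    set D := K * b₁⁻¹ ^ N with hD
    have hD0 : 0 < D := by positivity
    obtain ⟨-, hθ, hθi⟩ := ω.2.1
    obtain ⟨-, hθ', hθi'⟩ := ω'.2.1
    set θ := ω.1.1
    set θ' := ω'.1.1
    have hre : |(θ - θ').re| ≤ D := by
      rw [Complex.sub_re]
      rw [← mul_sub, abs_mul, abs_two] at hA1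
      linarith [abs_nonneg (θ.re - θ'.re)]
    have him : |(θ - θ').im| ≤ (1 + b₂) / η * D := by
      have e : (θ.im - θ'.im) * (θ.im + θ'.im) =
          (‖θ‖ ^ 2 - ‖θ'‖ ^ 2) - (θ.re - θ'.re) * (θ.re + θ'.re) := by
        rw [← Complex.normSq_eq_norm_sq, ← Complex.normSq_eq_norm_sq, Complex.normSq_apply,
          Complex.normSq_apply]
        ring
      have h1 : |θ.re + θ'.re| ≤ 2 * b₂ := by
        have h3 := (Complex.abs_re_le_norm θ).trans hθ
        have h4 := (Complex.abs_re_le_norm θ').trans hθ'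
        linarith [abs_add_le θ.re θ'.re]
      have h2 : |θ.im - θ'.im| * (2 * η) ≤ 2 * ((1 + b₂) * D) := by
        calc |θ.im - θ'.im| * (2 * η) ≤ |θ.im - θ'.im| * |θ.im + θ'.im| := by
              gcongr
              exact le_trans (by linarith) (le_abs_self _)
          _ = |(‖θ‖ ^ 2 - ‖θ'‖ ^ 2) - (θ.re - θ'.re) * (θ.re + θ'.re)| := by rw [← abs_mul, e]
          _ ≤ |‖θ‖ ^ 2 - ‖θ'‖ ^ 2| + |θ.re - θ'.re| * |θ.re + θ'.re| := by
              rw [← abs_mul]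
              exact abs_sub _ _
          _ ≤ D + D * (2 * b₂) := by
              gcongr
              simpa using hre
          _ ≤ 2 * ((1 + b₂) * D) := by linarith
      rw [Complex.sub_im, div_mul_eq_mul_div, le_div_iff₀ hη]
      linarith
    calc dist θ θ' = ‖θ - θ'‖ := dist_eq_norm _ _
      _ ≤ |(θ - θ').re| + |(θ - θ').im| := Complex.norm_le_abs_re_add_abs_im _
      _ ≤ D + (1 + b₂) / η * D := add_le_add hre him
      _ = K * (1 + (1 + b₂) / η) * b₁⁻¹ ^ N := by rw [hD]; ring
  · rintro θ ⟨hθ, hθE⟩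
    obtain ⟨N₁, hN₁⟩ := eventually_atTop.1 (not_frequently.1 hθE)
    refine ⟨N₁, fun N hN τ hτ hτ' => le_of_not_gt fun hlt => hN₁ N hN ?_⟩
    exact ⟨⟨(θ, τ), hθ, hτ, hτ'⟩, rfl, hlt⟩

theorem dimH_preimage_conj (E : Set ℂ) : dimH ((starRingEnd ℂ) ⁻¹' E) = dimH E :=
  Complex.conjLIE.toIsometryEquiv.dimH_preimage E

/-- The statement of `exists_exceptional_upper` for both half planes, with one exceptional set. -/
theorem exists_exceptional {s : ℝ≥0} (hs : 0 < s) {b₁ b₂ η : ℝ} (hb₁ : 1 < b₁) (hb : b₁ < b₂)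
    (hη : 0 < η) :
    ∃ (E : Set ℂ) (ρ δ : ℝ), 0 < ρ ∧ ρ ≤ 1 / 2 ∧ 0 < δ ∧ dimH E ≤ s ∧
      ∀ θ : ℂ, b₁ ≤ ‖θ‖ → ‖θ‖ ≤ b₂ → η < |θ.im| → θ ∉ E →
        ∃ N₀ : ℕ, ∀ N ≥ N₀, ∀ τ : ℂ, 1 ≤ ‖τ‖ → ‖τ‖ ≤ b₂ →
        δ * N ≤ farCount ρ (fun k => (τ * θ ^ k).re) N := by
  obtain ⟨E, ρ, δ, hρ, hρ', hδ, hE, H⟩ := exists_exceptional_upper hs hb₁ hb hη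
  refine ⟨E ∪ (starRingEnd ℂ) ⁻¹' E, ρ, δ, hρ, hρ', hδ, ?_, fun θ h1 h2 h3 h4 => ?_⟩
  · rw [dimH_union, dimH_preimage_conj, max_self]
    exact hE
  · rw [mem_union, not_or] at h4
    rcases lt_abs.1 h3 with h5 | h5
    · exact H θ ⟨⟨h1, h2, h5⟩, h4.1⟩
    · obtain ⟨N₀, hN₀⟩ := H ((starRingEnd ℂ) θ)
        ⟨⟨by simpa using h1, by simpa using h2, by simpa using h5⟩, h4.2⟩
      refine ⟨N₀, fun N hN τ hτ hτ' => ?_⟩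
      have := hN₀ N hN ((starRingEnd ℂ) τ) (by simpa using hτ) (by simpa using hτ')
      simpa only [← map_pow, ← map_mul, Complex.conj_re] using this

/-! ### Exceptional translation ratios -/

/-- For fixed `θ` and all bounded `t` outside a set of small dimension, one of the sequences
`Re (τ θ ^ k)` and `Re (t τ θ ^ k)` has a definite proportion of terms far from the integers. -/
theorem exists_exceptional_ratio_bounded {θ : ℂ} (hθ : 1 < ‖θ‖) (hθi : θ.im ≠ 0) {s : ℝ≥0}
    (hs : 0 < s) {R : ℝ} (hR : 0 < R) :
    ∃ (E : Set ℂ) (ρ δ : ℝ), 0 < ρ ∧ ρ ≤ 1 / 2 ∧ 0 < δ ∧ dimH E ≤ s ∧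
      ∀ t : ℂ, ‖t‖ ≤ R → t ∉ E → ∃ N₀ : ℕ, ∀ N ≥ N₀, ∀ τ : ℂ, 1 ≤ ‖τ‖ → ‖τ‖ ≤ ‖θ‖ →
        δ * N ≤ farCount ρ (fun k => (τ * θ ^ k).re) N ∨
        δ * N ≤ farCount ρ (fun k => (t * τ * θ ^ k).re) N := by
  have hr1 : ‖θ‖⁻¹ < 1 := inv_lt_one_of_one_lt₀ hθ
  have hr0 : 0 < ‖θ‖⁻¹ := inv_pos.2 (by linarith)
  obtain ⟨q, hq1, -, hq⟩ := exists_one_lt_sq_mul_rpow_lt_one hr0 hr1 (NNReal.coe_pos.2 hs)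
  set R' := (1 + R) * ‖θ‖ with hR'
  have hR'0 : 0 < R' := by positivity
  let Ω := {τ : ℂ // ‖τ‖ ≤ R'}
  set x : ℕ → Ω → ℝ := fun n ω => (ω.1 * θ ^ n).re with hx
  obtain ⟨ρ, δ, A, N₀, hρ, hρ', hδ, hA, H⟩ := exists_finset_round_of_farCount_lt x 2
    (2 * ‖θ‖ + ‖θ‖ ^ 2) (R' * ‖θ‖) (by positivity) (by
      intro n ω ω' d _ h
      have hrec : ∀ ω : Ω, x (n + 2) ω = 2 * θ.re * x (n + 1) ω - ‖θ‖ ^ 2 * x (n + 0) ω := by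
        exact fun ω => Complex.re_mul_pow_add_two _ _ _
      have e : x (n + 2) ω - x (n + 2) ω' = 2 * θ.re * (x (n + 1) ω - x (n + 1) ω') -
          ‖θ‖ ^ 2 * (x (n + 0) ω - x (n + 0) ω') := by
        rw [hrec, hrec]; ring
      have h0 := h 0 (by norm_num)
      have h1 := h 1 (by norm_num)
      rw [e]
      calc _ ≤ 2 * |θ.re| * |x (n + 1) ω - x (n + 1) ω'| +
            ‖θ‖ ^ 2 * |x (n + 0) ω - x (n + 0) ω'| := by
            refine (abs_sub _ _).trans (le_of_eq ?_)
            rw [abs_mul, abs_mul, abs_mul, abs_two, abs_of_nonneg (sq_nonneg ‖θ‖)]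
        _ ≤ 2 * ‖θ‖ * d + ‖θ‖ ^ 2 * d := by
            gcongr
            exact Complex.abs_re_le_norm _
        _ = _ := by ring) (by
      intro ω i hi
      refine (Complex.abs_re_mul_pow_le le_rfl i).trans ?_
      have h1 : ‖θ‖ ^ i ≤ ‖θ‖ := by
        simpa using pow_le_pow_right₀ hθ.le (Nat.le_of_lt_succ hi)
      have h2 := ω.2
      gcongr) hq1
  set F : ℕ → Set ℂ := fun N => {t | ‖t‖ ≤ R ∧ ∃ τ : ℂ, 1 ≤ ‖τ‖ ∧ ‖τ‖ ≤ ‖θ‖ ∧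
    (farCount ρ (fun k => (τ * θ ^ k).re) N : ℝ) < δ * N ∧
    (farCount ρ (fun k => (t * τ * θ ^ k).re) N : ℝ) < δ * N}
  let st : ℕ → ℂ → (Fin 2 → ℤ) := fun N τ i => round (τ * θ ^ (N + (i : ℕ))).re
  set U : ℕ → (Fin 2 → ℤ) × (Fin 2 → ℤ) → Set ℂ := fun N f =>
    {t | ‖t‖ ≤ R ∧ ∃ τ : ℂ, 1 ≤ ‖τ‖ ∧ st N τ = f.1 ∧ st N (t * τ) = f.2}
  set K : ℝ := (1 + (1 + ‖θ‖) / |θ.im|) with hK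
  have hK0 : 0 < K := by positivity
  -- Sequences with the same rounded terms at times `N` and `N + 1` are `O(1)`-close at time `N`.
  have hclose : ∀ N τ τ', st N τ = st N τ' → ‖τ * θ ^ N - τ' * θ ^ N‖ ≤ K := by
    intro N τ τ' h
    rw [← mul_one K]
    refine Complex.norm_le_of_abs_re_le zero_le_one le_rfl hθi ?_ ?_
    · exact abs_sub_le_one_of_round_eq (congrFun h 0)
    · rw [sub_mul, mul_assoc, mul_assoc, ← pow_succ]
      exact abs_sub_le_one_of_round_eq (congrFun h 1)
  refine ⟨{t | ∃ᶠ N in atTop, t ∈ F N}, ρ, δ, hρ, hρ', hδ,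
    dimH_limsup_le F U (A := A ^ 2) (q := q ^ 2) (C := K * (1 + R)) (by positivity)
      (by positivity) (by positivity) hr0 hr1 hq (N₀ := N₀) ?_ ?_, ?_⟩
  · intro N hN
    obtain ⟨T, hT, hT'⟩ := H N hN
    refine ⟨T ×ˢ T, ?_, ?_⟩
    · rw [Finset.card_product, Nat.cast_mul]
      calc (T.card : ℝ) * T.card ≤ (A * q ^ N) * (A * q ^ N) := by gcongr
        _ = A ^ 2 * (q ^ 2) ^ N := by rw [← pow_mul, mul_comm 2 N, pow_mul]; ring
    · rintro t ⟨ht, τ, hτ, hτ', h1, h2⟩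
      have hΩ : ‖τ‖ ≤ R' := hτ'.trans (le_mul_of_one_le_left (norm_nonneg _) (by linarith))
      have hΩ' : ‖t * τ‖ ≤ R' := by
        rw [norm_mul, hR']
        gcongr
        linarith
      exact mem_iUnion₂.2 ⟨(st N τ, st N (t * τ)),
        Finset.mem_product.2 ⟨hT' ⟨τ, hΩ⟩ h1, hT' ⟨t * τ, hΩ'⟩ h2⟩, ht, τ, hτ, rfl, rfl⟩
  · rintro N - ⟨f, g⟩ t ⟨-, τ, hτ, h1, h2⟩ t' ⟨ht', τ', -, h1', h2'⟩
    have hz := hclose N τ τ' (h1.trans h1'.symm)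
    have hw := hclose N (t * τ) (t' * τ') (h2.trans h2'.symm)
    have hpos : 0 < ‖θ‖ ^ N := by positivity
    rw [inv_pow, ← div_eq_mul_inv, le_div_iff₀ hpos, dist_eq_norm]
    calc ‖t - t'‖ * ‖θ‖ ^ N ≤ ‖t - t'‖ * ‖τ * θ ^ N‖ := by
          rw [norm_mul τ, norm_pow]
          gcongr
          exact le_mul_of_one_le_left hpos.le hτ
      _ = ‖(t * τ * θ ^ N - t' * τ' * θ ^ N) - t' * (τ * θ ^ N - τ' * θ ^ N)‖ := by
          rw [← norm_mul]
          congr 1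
          ring
      _ ≤ ‖t * τ * θ ^ N - t' * τ' * θ ^ N‖ + ‖t'‖ * ‖τ * θ ^ N - τ' * θ ^ N‖ := by
          rw [← norm_mul t']
          exact norm_sub_le _ _
      _ ≤ K + R * K := by gcongr
      _ = K * (1 + R) := by ring
  · rintro t ht htE
    obtain ⟨N₁, hN₁⟩ := eventually_atTop.1 (not_frequently.1 htE)
    refine ⟨N₁, fun N hN τ hτ hτ' => ?_⟩
    by_contra! h
    exact hN₁ N hN ⟨ht, τ, hτ, hτ', h.1, h.2⟩

theorem dimH_iInter_eq_zero {X : Type*} [MetricSpace X] {E : ℕ → Set X}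
    (hE : ∀ n : ℕ, dimH (E n) ≤ ((1 / (n + 1) : ℝ≥0) : ℝ≥0∞)) : dimH (⋂ n, E n) = 0 := by
  have h1 : Tendsto (fun n : ℕ => ((1 / (n + 1) : ℝ≥0) : ℝ≥0∞)) atTop (𝓝 0) := by
    have := tendsto_one_div_add_atTop_nhds_zero_nat (𝕜 := ℝ≥0)
    simpa only [ENNReal.coe_zero] using ENNReal.tendsto_coe.2 this
  exact nonpos_iff_eq_zero.1 (ge_of_tendsto' h1 fun n => (dimH_mono (iInter_subset _ n)).trans
    (hE n))

/-- For fixed `θ` and all `t` outside a set of dimension zero, one of the sequences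
`Re (τ θ ^ k)` and `Re (t τ θ ^ k)` has a definite proportion of terms far from the integers. -/
theorem exists_exceptional_ratio {θ : ℂ} (hθ : 1 < ‖θ‖) (hθi : θ.im ≠ 0) :
    ∃ E : Set ℂ, dimH E = 0 ∧ ∀ t ∉ E, ∃ ρ δ : ℝ, 0 < ρ ∧ ρ ≤ 1 / 2 ∧ 0 < δ ∧
      ∃ N₀ : ℕ, ∀ N ≥ N₀, ∀ τ : ℂ, 1 ≤ ‖τ‖ → ‖τ‖ ≤ ‖θ‖ →
        δ * N ≤ farCount ρ (fun k => (τ * θ ^ k).re) N ∨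
        δ * N ≤ farCount ρ (fun k => (t * τ * θ ^ k).re) N := by
  choose E ρ δ hρ hρ' hδ hE H using fun m n : ℕ => exists_exceptional_ratio_bounded hθ hθi
    (s := 1 / (n + 1)) (by positivity) (R := m + 1) (by positivity)
  refine ⟨⋃ m, ⋂ n, E m n, ?_, fun t ht => ?_⟩
  · rw [dimH_iUnion]
    simp [fun m => dimH_iInter_eq_zero (hE m)]
  · obtain ⟨m, hm⟩ := exists_nat_ge ‖t‖
    simp only [mem_iUnion, mem_iInter, not_exists, not_forall] at ht
    obtain ⟨n, hn⟩ := ht m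
    exact ⟨ρ m n, δ m n, hρ m n, hρ' m n, hδ m n, H m n t (by linarith) hn⟩

/-! ### Fourier decay from terms far from the integers -/

/-- The characteristic function of the law of one digit `a i`, chosen with probability `p i`. -/
def digitCharFun {Λ : Type u} [Fintype Λ] (a : Λ → ℂ) (p : Λ → ℝ) (t : ℂ) : ℂ :=
  ∑ i, (p i : ℂ) * Complex.exp (inner ℝ (a i) t * Complex.I)

theorem norm_digitCharFun_le_one {Λ : Type u} [Fintype Λ] (a : Λ → ℂ) {p : Λ → ℝ}
    (hp : p ∈ openSimplex Λ) (t : ℂ) : ‖digitCharFun a p t‖ ≤ 1 := by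
  refine (norm_sum_le _ _).trans (le_of_eq ?_)
  rw [← hp.2]
  refine Finset.sum_congr rfl fun i _ => ?_
  rw [norm_mul, Complex.norm_exp_ofReal_mul_I, mul_one, Complex.norm_real, Real.norm_eq_abs,
    abs_of_pos (hp.1 i)]

theorem IsSelfSimilarMeasure.charFun_eq_prod {Λ : Type u} [Fintype Λ] {lam : ℂ} {a : Λ → ℂ}
    {p : Λ → ℝ} {μ : Measure ℂ} (h : IsSelfSimilarMeasure lam a p μ) (hp : p ∈ openSimplex Λ)
    (t : ℂ) (N : ℕ) :
    charFun μ t = (∏ n ∈ Finset.range N, digitCharFun a p ((starRingEnd ℂ) lam ^ n * t)) *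
      charFun μ ((starRingEnd ℂ) lam ^ N * t) := by
  induction N with
  | zero => simp
  | succ N ih =>
    have := h.charFun_eq hp ((starRingEnd ℂ) lam ^ N * t)
    rw [← digitCharFun, ← mul_assoc, ← pow_succ'] at this
    rw [ih, this, Finset.prod_range_succ, mul_assoc]

theorem measureFourier_eq_charFun (μ : Measure ℂ) (ξ : ℂ) :
    measureFourier μ ξ = charFun μ (2 * Real.pi * ξ) := by
  rw [measureFourier, charFun_apply]
  congr 1
  funext z
  have : inner ℝ z (2 * Real.pi * ξ) = 2 * Real.pi * (z * (starRingEnd ℂ) ξ).re := by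
    simp only [Complex.inner, Complex.mul_re, Complex.mul_im, Complex.conj_re, Complex.conj_im,
      Complex.re_ofNat, Complex.im_ofNat, Complex.ofReal_re, Complex.ofReal_im]
    ring
  rw [this]
  push_cast
  ring_nf

theorem norm_exp_mul_I_add_exp_mul_I (x y : ℝ) :
    ‖Complex.exp (x * Complex.I) + Complex.exp (y * Complex.I)‖ = 2 * |Real.cos ((x - y) / 2)| := by
  have e : Complex.exp (x * Complex.I) + Complex.exp (y * Complex.I) =
      Complex.exp (((x + y) / 2 : ℝ) * Complex.I) * (2 * Real.cos ((x - y) / 2) : ℝ) := by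
    push_cast
    rw [Complex.two_cos, mul_add, ← Complex.exp_add, ← Complex.exp_add]
    ring_nf
  rw [e, norm_mul, Complex.norm_exp_ofReal_mul_I, one_mul, Complex.norm_real, Real.norm_eq_abs,
    abs_mul, abs_two]

/-- A phase difference far from the integers makes the digit sum contract, at a rate depending only
on the weights. -/
theorem exists_norm_digitCharFun_le {Λ : Type u} [Fintype Λ] {p : Λ → ℝ} (hp : p ∈ openSimplex Λ)
    {ρ : ℝ} (hρ : 0 < ρ) (hρ' : ρ ≤ 1 / 2) :
    ∃ κ : ℝ, 0 < κ ∧ κ < 1 ∧ ∀ (a : Λ → ℂ) (i j : Λ) (t : ℂ),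
      ρ ≤ |((a j - a i) * (starRingEnd ℂ) t).re - round ((a j - a i) * (starRingEnd ℂ) t).re| →
      ‖digitCharFun a p (2 * Real.pi * t)‖ ≤ κ := by
  classical
  obtain ⟨m, hm0, hm⟩ : ∃ m : ℝ, 0 < m ∧ ∀ i, m ≤ p i := by
    have hne : Nonempty Λ := by
      by_contra hc
      rw [not_nonempty_iff] at hc
      have := hp.2
      simp at this
    obtain ⟨i, hi⟩ := Finite.exists_min p
    exact ⟨p i, hp.1 i, hi⟩
  set c := Real.cos (Real.pi * ρ) with hc
  have hc1 : c < 1 := by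
    rw [hc, ← Real.cos_zero]
    exact Real.cos_lt_cos_of_nonneg_of_le_pi le_rfl (by nlinarith [Real.pi_pos])
      (by positivity)
  refine ⟨max (1 / 2) (1 - 2 * m * (1 - c)), lt_max_of_lt_left (by norm_num),
    max_lt (by norm_num) (by nlinarith), fun a i j t h => le_max_of_le_right ?_⟩
  have hij : i ≠ j := by
    rintro rfl
    simp at h
    linarith
  set x : Λ → ℝ := fun i => inner ℝ (a i) (2 * Real.pi * t) with hx
  have hsplit : ∀ f : Λ → ℂ, ∑ k, f k = (f i + f j) + ∑ k ∈ (Finset.univ \ {i, j}), f k := by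
    intro f
    rw [← Finset.sum_pair hij, add_comm, Finset.sum_sdiff (Finset.subset_univ _)]
  have hsplit' : ∑ k, p k = (p i + p j) + ∑ k ∈ (Finset.univ \ {i, j}), p k := by
    rw [← Finset.sum_pair hij, add_comm, Finset.sum_sdiff (Finset.subset_univ _)]
  have hnorm : ∀ (r : ℝ) (y : ℝ), 0 ≤ r → ‖(r : ℂ) * Complex.exp (y * Complex.I)‖ = r := by
    intro r y hr
    rw [norm_mul, Complex.norm_exp_ofReal_mul_I, mul_one, Complex.norm_real, Real.norm_eq_abs,
      abs_of_nonneg hr]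
  have hcos : |Real.cos ((x j - x i) / 2)| ≤ c := by
    set v := ((a j - a i) * (starRingEnd ℂ) t).re with hv
    have e : (x j - x i) / 2 = Real.pi * (v - round v) + round v * Real.pi := by
      simp only [hx, hv, Complex.inner, Complex.mul_re, Complex.mul_im, Complex.conj_re,
        Complex.conj_im, Complex.re_ofNat, Complex.im_ofNat, Complex.ofReal_re, Complex.ofReal_im,
        Complex.sub_re, Complex.sub_im]
      ring
    rw [e, Real.cos_add_int_mul_pi, abs_mul]
    have h1 : |((-1 : ℝ)) ^ (round v)| = 1 := by
      rw [abs_zpow, abs_neg, abs_one, one_zpow]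
    have h2 := abs_sub_round v
    have h3 : Real.cos (Real.pi * (v - round v)) = Real.cos (Real.pi * |v - round v|) := by
      rw [← Real.cos_abs, abs_mul, abs_of_pos Real.pi_pos]
    rw [h1, one_mul, h3, abs_of_nonneg]
    · exact Real.cos_le_cos_of_nonneg_of_le_pi (by positivity) (by nlinarith [Real.pi_pos])
        (by gcongr)
    · refine Real.cos_nonneg_of_neg_pi_div_two_le_of_le ?_ ?_
      · have : 0 ≤ Real.pi * |v - round v| := by positivity
        linarith [Real.pi_pos]
      · nlinarith [Real.pi_pos]
  have hpair : ‖(p i : ℂ) * Complex.exp (x i * Complex.I) + p j * Complex.exp (x j * Complex.I)‖ ≤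
      2 * m * c + (p i - m) + (p j - m) := by
    have e : (p i : ℂ) * Complex.exp (x i * Complex.I) + p j * Complex.exp (x j * Complex.I) =
        m * (Complex.exp (x j * Complex.I) + Complex.exp (x i * Complex.I)) +
        ((p i - m : ℝ) : ℂ) * Complex.exp (x i * Complex.I) +
        ((p j - m : ℝ) : ℂ) * Complex.exp (x j * Complex.I) := by
      push_cast; ring
    rw [e]
    refine (norm_add₃_le).trans ?_
    rw [hnorm _ _ (sub_nonneg.2 (hm i)), hnorm _ _ (sub_nonneg.2 (hm j)), norm_mul,
      norm_exp_mul_I_add_exp_mul_I, Complex.norm_real, Real.norm_eq_abs, abs_of_pos hm0]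
    nlinarith
  have hrest : ‖∑ k ∈ (Finset.univ \ {i, j}), (p k : ℂ) * Complex.exp (x k * Complex.I)‖ ≤
      ∑ k ∈ (Finset.univ \ {i, j}), p k :=
    (norm_sum_le _ _).trans (Finset.sum_le_sum fun k _ => (hnorm _ _ (hp.1 k).le).le)
  rw [digitCharFun, hsplit]
  refine (norm_add_le _ _).trans ((add_le_add hpair hrest).trans ?_)
  have := hp.2
  rw [hsplit'] at this
  linarith

/-- If `B (w₀ * conj t)` forces a contraction of the digit sum at `t`, and the geometric progression
`τ * lam⁻¹ ^ k` satisfies `B` for a definite proportion of `k`, then the Fourier transform decays,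
since `|lam| ^ N |ξ|` is of order `1` for some `N` of order `log |ξ|`. -/
theorem hasFourierDecay_of_proportion {Λ : Type u} [Fintype Λ] {lam : ℂ} (hlam : ‖lam‖ < 1)
    (hlam0 : lam ≠ 0) {a : Λ → ℂ} {p : Λ → ℝ} (hp : p ∈ openSimplex Λ) {w₀ : ℂ} (hw₀ : w₀ ≠ 0)
    (B : ℂ → Prop) {κ δ b : ℝ} (hκ0 : 0 < κ) (hκ1 : κ < 1) (hδ : 0 < δ) (hb : ‖lam⁻¹‖ ≤ b)
    (hB : ∀ t, B (w₀ * (starRingEnd ℂ) t) → ‖digitCharFun a p (2 * Real.pi * t)‖ ≤ κ)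
    {N₀ : ℕ} (hcount : ∀ N ≥ N₀, ∀ τ : ℂ, 1 ≤ ‖τ‖ → ‖τ‖ ≤ ‖lam⁻¹‖ →
      δ * N ≤ ({k ∈ (Finset.range N : Set ℕ) | B (τ * lam⁻¹ ^ k)}).ncard) :
    HasFourierDecay (selfSimilarMeasure lam a p) (δ * Real.log κ⁻¹ / Real.log b) := by
  classical
  have hss := isSelfSimilarMeasure_selfSimilarMeasure hlam a hp
  have hprob := hss.1
  have hb1 : 1 < ‖lam⁻¹‖ := by
    rw [norm_inv]
    exact (one_lt_inv₀ (norm_pos_iff.2 hlam0)).2 hlam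
  have hb0 : 1 < b := hb1.trans_le hb
  have hκi : 1 < κ⁻¹ := (one_lt_inv₀ hκ0).2 hκ1
  set γ := δ * Real.log κ⁻¹ / Real.log b with hγ
  have hγ0 : 0 < γ := div_pos (mul_pos hδ (Real.log_pos hκi)) (Real.log_pos hb0)
  have hbγ : b ^ γ = κ⁻¹ ^ δ := by
    rw [Real.rpow_def_of_pos (by linarith), Real.rpow_def_of_pos (by linarith), hγ,
      mul_div_cancel₀ _ (Real.log_pos hb0).ne', mul_comm]
  set C₀ : ℝ := κ⁻¹ ^ (δ * N₀) with hC₀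
  have hC₀1 : 1 ≤ C₀ := Real.one_le_rpow hκi.le (by positivity)
  have hw₀' : 0 < ‖w₀‖ := norm_pos_iff.2 hw₀
  refine ⟨C₀ * ‖w₀‖ ^ (-γ), by positivity, fun ξ hξ => ?_⟩
  rw [measureFourier_eq_charFun, mul_assoc C₀,
    ← Real.mul_rpow (norm_nonneg _) (norm_nonneg _)]
  set w := w₀ * (starRingEnd ℂ) ξ with hw
  have hwn : ‖w₀‖ * ‖ξ‖ = ‖w‖ := by rw [hw, norm_mul, RCLike.norm_conj]
  have hwpos : 0 < ‖w‖ := by rw [← hwn]; positivity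
  rw [hwn]
  rcases lt_or_ge ‖w‖ 1 with h1 | h1
  · calc _ ≤ 1 := norm_charFun_le_one _
      _ ≤ ‖w‖ ^ (-γ) := Real.one_le_rpow_of_pos_of_le_one_of_nonpos hwpos h1.le (by linarith)
      _ ≤ C₀ * ‖w‖ ^ (-γ) := le_mul_of_one_le_left (by positivity) hC₀1
  obtain ⟨N, hN, hN'⟩ := exists_nat_pow_near h1 hb1
  set τ := w * lam ^ N with hτ
  have hτn : ‖τ‖ * ‖lam⁻¹‖ ^ N = ‖w‖ := by
    rw [← norm_pow, ← norm_mul, hτ, mul_assoc, ← mul_pow, mul_inv_cancel₀ hlam0, one_pow, mul_one]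
  have hτ1 : 1 ≤ ‖τ‖ := by
    by_contra! hc
    have : ‖τ‖ * ‖lam⁻¹‖ ^ N < 1 * ‖lam⁻¹‖ ^ N := by gcongr
    linarith
  have hτ2 : ‖τ‖ ≤ ‖lam⁻¹‖ := by
    by_contra! hc
    have : ‖lam⁻¹‖ * ‖lam⁻¹‖ ^ N < ‖τ‖ * ‖lam⁻¹‖ ^ N := by gcongr
    rw [← pow_succ'] at this
    linarith
  set S := (Finset.range (N + 1)).filter fun k => B (τ * lam⁻¹ ^ k) with hS
  have hSc : ({k ∈ (Finset.range (N + 1) : Set ℕ) | B (τ * lam⁻¹ ^ k)}).ncard = S.card := by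
    rw [← ncard_coe_finset, hS]
    congr 1
    ext k
    simp
  have hprod : ‖charFun (selfSimilarMeasure lam a p) (2 * Real.pi * ξ)‖ ≤ κ ^ S.card := by
    rw [hss.charFun_eq_prod hp _ (N + 1), norm_mul, norm_prod]
    calc _ ≤ (∏ n ∈ Finset.range (N + 1),
          ‖digitCharFun a p ((starRingEnd ℂ) lam ^ n * (2 * Real.pi * ξ))‖) * 1 := by
          gcongr
          exact norm_charFun_le_one _
      _ = ∏ k ∈ Finset.range (N + 1),
          ‖digitCharFun a p ((starRingEnd ℂ) lam ^ (N - k) * (2 * Real.pi * ξ))‖ := by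
          rw [mul_one, ← Finset.prod_range_reflect]
          simp
      _ ≤ ∏ k ∈ Finset.range (N + 1), if B (τ * lam⁻¹ ^ k) then κ else 1 := by
          refine Finset.prod_le_prod (fun _ _ => norm_nonneg _) fun k hk => ?_
          have hk : k ≤ N := Nat.le_of_lt_succ (Finset.mem_range.1 hk)
          have e : (starRingEnd ℂ) lam ^ (N - k) * (2 * Real.pi * ξ) =
              2 * Real.pi * ((starRingEnd ℂ) lam ^ (N - k) * ξ) := by ring
          split_ifs with hBk
          · rw [e]
            refine hB _ ?_
            convert! hBk using 1
            have e2 : lam ^ N = lam ^ (N - k) * lam ^ k := by rw [← pow_add, Nat.sub_add_cancel hk]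
            rw [map_mul, map_pow, Complex.conj_conj, hτ, hw, e2, inv_pow]
            field_simp
          · exact norm_digitCharFun_le_one a hp _
      _ = κ ^ S.card := by
          rw [Finset.prod_ite, Finset.prod_const, Finset.prod_const, one_pow, mul_one]
  have hlow : ‖w‖ ^ γ ≤ κ⁻¹ ^ (δ * ((N + 1 : ℕ) : ℝ)) := by
    calc ‖w‖ ^ γ ≤ (b ^ (N + 1)) ^ γ := by
          gcongr
          exact hN'.le.trans (by gcongr)
      _ = (b ^ γ) ^ (N + 1) := by
          rw [← Real.rpow_natCast, ← Real.rpow_natCast, ← Real.rpow_mul (by linarith),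
            ← Real.rpow_mul (by linarith), mul_comm]
      _ = _ := by rw [hbγ, ← Real.rpow_natCast, ← Real.rpow_mul (by linarith)]
  have hκS : κ ^ S.card * κ⁻¹ ^ (δ * ((N + 1 : ℕ) : ℝ)) ≤ C₀ := by
    have e : κ ^ S.card = κ⁻¹ ^ (-(S.card : ℝ)) := by
      rw [Real.rpow_neg (by linarith), Real.rpow_natCast, inv_pow, inv_inv]
    rw [e, ← Real.rpow_add (by linarith), hC₀]
    refine Real.rpow_le_rpow_of_exponent_le hκi.le ?_
    rcases le_or_gt N₀ (N + 1) with h2 | h2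
    · have := hcount (N + 1) h2 τ hτ1 hτ2
      rw [hSc] at this
      have : 0 ≤ δ * N₀ := by positivity
      linarith
    · have h3 : ((N + 1 : ℕ) : ℝ) ≤ N₀ := by exact_mod_cast h2.le
      have h4 : δ * ((N + 1 : ℕ) : ℝ) ≤ δ * N₀ := by gcongr
      have : (0 : ℝ) ≤ S.card := by positivity
      linarith
  rw [Real.rpow_neg hwpos.le, ← div_eq_mul_inv, le_div_iff₀ (by positivity)]
  calc _ ≤ κ ^ S.card * κ⁻¹ ^ (δ * ((N + 1 : ℕ) : ℝ)) := by gcongr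
    _ ≤ C₀ := hκS

/-- Outside a set of parameters of small dimension, Fourier decay holds with an exponent that
depends on the weights but not on the digits. -/
theorem exists_exceptional_fourierDecay {s : ℝ≥0} (hs : 0 < s) {b₁ b₂ η : ℝ} (hb₁ : 1 < b₁)
    (hb : b₁ < b₂) (hη : 0 < η) :
    ∃ E : Set ℂ, dimH E ≤ s ∧
      ∀ (Λ : Type u) [Fintype Λ] (p : Λ → ℝ), p ∈ openSimplex Λ →
        ∃ γ : ℝ, 0 < γ ∧ ∀ a : Λ → ℂ, (∃ i j, a i ≠ a j) →
          ∀ lam : ℂ, b₁ ≤ ‖lam⁻¹‖ → ‖lam⁻¹‖ ≤ b₂ → η < |(lam⁻¹).im| → lam⁻¹ ∉ E →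
            HasFourierDecay (selfSimilarMeasure lam a p) γ := by
  obtain ⟨E, ρ, δ, hρ, hρ', hδ, hE, H⟩ := exists_exceptional hs hb₁ hb hη
  refine ⟨E, hE, fun Λ _ p hp => ?_⟩
  obtain ⟨κ, hκ0, hκ1, hκ⟩ := exists_norm_digitCharFun_le hp hρ hρ'
  refine ⟨δ * Real.log κ⁻¹ / Real.log b₂,
    div_pos (mul_pos hδ (Real.log_pos ((one_lt_inv₀ hκ0).2 hκ1))) (Real.log_pos (hb₁.trans hb)),
    ?_⟩
  rintro a ⟨i, j, hij⟩ lam h1 h2 h3 h4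
  have hlam0 : lam ≠ 0 := by
    rintro rfl
    simp at h3
    linarith
  have hlam : ‖lam‖ < 1 := by
    rw [norm_inv] at h1
    exact (one_lt_inv₀ (norm_pos_iff.2 hlam0)).1 (hb₁.trans_le h1)
  obtain ⟨N₀, hN₀⟩ := H _ h1 h2 h3 h4
  exact hasFourierDecay_of_proportion hlam hlam0 hp (w₀ := a j - a i) (sub_ne_zero.2 hij.symm)
    (fun z => ρ ≤ |z.re - round z.re|) hκ0 hκ1 hδ h2 (fun t ht => hκ a i j t ht)
    fun N hN τ hτ hτ' => hN₀ N hN τ hτ (hτ'.trans h2)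

/-- Three digits whose ratio avoids an exceptional set give Fourier decay. -/
theorem exists_exceptional_ratio_fourierDecay {lam : ℂ} (hlam : ‖lam‖ < 1) (hlami : lam.im ≠ 0) :
    ∃ E : Set ℂ, dimH E = 0 ∧
      ∀ (Λ : Type u) [Fintype Λ] (a : Λ → ℂ) (p : Λ → ℝ), p ∈ openSimplex Λ →
        ∀ i j k : Λ, a i ≠ a j → (a k - a i) / (a j - a i) ∉ E →
          ∃ γ : ℝ, 0 < γ ∧ HasFourierDecay (selfSimilarMeasure lam a p) γ := by
  have hlam0 : lam ≠ 0 := by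
    rintro rfl
    simp at hlami
  have hθ : 1 < ‖lam⁻¹‖ := by
    rw [norm_inv]
    exact (one_lt_inv₀ (norm_pos_iff.2 hlam0)).2 hlam
  have hθi : (lam⁻¹).im ≠ 0 := by
    rw [Complex.inv_im]
    exact div_ne_zero (neg_ne_zero.2 hlami) (by simpa using hlam0)
  obtain ⟨E, hE, H⟩ := exists_exceptional_ratio hθ hθi
  refine ⟨E, hE, fun Λ _ a p hp i j k hij ht => ?_⟩
  set t := (a k - a i) / (a j - a i) with htdef
  have hji : a j - a i ≠ 0 := sub_ne_zero.2 hij.symm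
  have hta : t * (a j - a i) = a k - a i := div_mul_cancel₀ _ hji
  obtain ⟨ρ, δ, hρ, hρ', hδ, N₀, hN₀⟩ := H t ht
  obtain ⟨κ, hκ0, hκ1, hκ⟩ := exists_norm_digitCharFun_le hp hρ hρ'
  refine ⟨δ * Real.log κ⁻¹ / Real.log ‖lam⁻¹‖,
    div_pos (mul_pos hδ (Real.log_pos ((one_lt_inv₀ hκ0).2 hκ1))) (Real.log_pos hθ), ?_⟩
  refine hasFourierDecay_of_proportion hlam hlam0 hp hji
    (fun z => ρ ≤ |z.re - round z.re| ∨ ρ ≤ |(t * z).re - round (t * z).re|) hκ0 hκ1 hδ le_rfl ?_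
    (N₀ := N₀) fun N hN τ hτ hτ' => ?_
  · rintro s (hs | hs)
    · exact hκ a i j s hs
    · rw [← mul_assoc, hta] at hs
      exact hκ a i k s hs
  · have hfin : ({k ∈ (Finset.range N : Set ℕ) | ρ ≤ |(τ * lam⁻¹ ^ k).re -
        round (τ * lam⁻¹ ^ k).re| ∨ ρ ≤ |(t * (τ * lam⁻¹ ^ k)).re -
        round (t * (τ * lam⁻¹ ^ k)).re|}).Finite :=
      (Finset.range N).finite_toSet.subset (sep_subset _ _)
    rcases hN₀ N hN τ hτ hτ' with h | h
    · exact h.trans (Nat.cast_le.2 (ncard_le_ncard (fun k hk => ⟨hk.1, Or.inl hk.2⟩) hfin))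
    · refine h.trans (Nat.cast_le.2 (ncard_le_ncard (fun k hk => ⟨hk.1, Or.inr ?_⟩) hfin))
      rw [← mul_assoc]
      exact hk.2

/-! ### Smooth densities from integrable Fourier transforms -/

theorem measureFourier_eq_fourierIntegral (μ : Measure ℂ) :
    measureFourier μ = VectorFourier.fourierIntegral Real.fourierChar μ (-innerₗ ℂ)
      (fun _ => (1 : ℂ)) := by
  funext ξ
  rw [measureFourier, VectorFourier.fourierIntegral]
  congr 1
  funext z
  have e : inner ℝ z ξ = (z * (starRingEnd ℂ) ξ).re := by
    simp only [Complex.inner, Complex.mul_re, Complex.conj_re, Complex.conj_im]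
    ring
  simp only [LinearMap.neg_apply, innerₗ_apply_apply, neg_neg, Circle.smul_def,
    Real.fourierChar_apply, smul_eq_mul, mul_one, e]
  push_cast
  ring_nf

theorem measurable_measureFourier (μ : Measure ℂ) [IsFiniteMeasure μ] :
    Measurable (measureFourier μ) := by
  have : measureFourier μ = fun ξ => charFun μ (2 * Real.pi * ξ) :=
    funext (measureFourier_eq_charFun μ)
  rw [this]
  exact measurable_charFun.comp (by fun_prop)

theorem norm_measureFourier_le_one (μ : Measure ℂ) [IsProbabilityMeasure μ] (ξ : ℂ) :
    ‖measureFourier μ ξ‖ ≤ 1 := by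
  rw [measureFourier_eq_charFun]
  exact norm_charFun_le_one _

theorem integrable_pow_mul_measureFourier {μ : Measure ℂ} [IsProbabilityMeasure μ] {k : ℕ} {s : ℝ}
    (hs : k + 2 < s) (h : HasFourierDecay μ s) {n : ℕ} (hn : n ≤ k) :
    Integrable (fun v => ‖v‖ ^ n * ‖measureFourier μ v‖) := by
  obtain ⟨C, hC, h⟩ := h
  set r : ℝ := s - k with hr
  have hr2 : 2 < r := by rw [hr]; linarith
  have hI : Integrable (fun v : ℂ => (2 : ℝ) ^ r * (1 + C) * (1 + ‖v‖) ^ (-r)) :=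
    (integrable_one_add_norm (by simpa using hr2)).const_mul _
  have hmeas := measurable_measureFourier μ
  refine hI.mono' (Measurable.aestronglyMeasurable (by fun_prop)) (Eventually.of_forall fun v => ?_)
  rw [Real.norm_of_nonneg (by positivity)]
  have h2 : ∀ x y : ℝ, 0 < x → y ≤ 2 * x → 0 < y → x ^ (-r) ≤ 2 ^ r * y ^ (-r) := by
    intro x y hx hxy hy
    calc x ^ (-r) = 2 ^ r * (2 * x) ^ (-r) := by
          rw [Real.mul_rpow (by norm_num) hx.le, ← mul_assoc, ← Real.rpow_add (by norm_num)]
          simp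
      _ ≤ 2 ^ r * y ^ (-r) := by
          gcongr 2 ^ r * ?_
          exact Real.rpow_le_rpow_of_nonpos hy hxy (by linarith)
  rcases le_total ‖v‖ 1 with hv | hv
  · calc ‖v‖ ^ n * ‖measureFourier μ v‖ ≤ 1 * 1 := by
          gcongr
          · exact pow_le_one₀ (norm_nonneg _) hv
          · exact norm_measureFourier_le_one μ v
      _ = 1 * (1 : ℝ) ^ (-r) := by rw [Real.one_rpow]
      _ ≤ (1 + C) * (2 ^ r * (1 + ‖v‖) ^ (-r)) := by
          gcongr
          · linarith
          · exact h2 1 (1 + ‖v‖) one_pos (by linarith) (by positivity)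
      _ = _ := by ring
  · have hv0 : 0 < ‖v‖ := by linarith
    calc ‖v‖ ^ n * ‖measureFourier μ v‖ ≤ ‖v‖ ^ k * (C * ‖v‖ ^ (-s)) := by
          gcongr ?_ * ?_
          · exact pow_le_pow_right₀ hv hn
          · exact h v (norm_pos_iff.1 hv0)
      _ = C * ‖v‖ ^ (-r) := by
          rw [← Real.rpow_natCast, mul_left_comm, ← Real.rpow_add hv0]
          congr 2
          rw [hr]; ring
      _ ≤ (1 + C) * (2 ^ r * (1 + ‖v‖) ^ (-r)) := by
          gcongr
          · linarith
          · exact h2 ‖v‖ (1 + ‖v‖) hv0 (by linarith) (by positivity)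
      _ = _ := by ring

/-- Fourier inversion, tested against smooth functions. -/
theorem integral_eq_integral_mul_fourier_measureFourier {μ : Measure ℂ} [IsProbabilityMeasure μ]
    (hI : Integrable (measureFourier μ)) {φ : ℂ → ℝ} (hφ : ContDiff ℝ (⊤ : ℕ∞) φ)
    (hφc : HasCompactSupport φ) :
    ((∫ z, φ z ∂μ : ℝ) : ℂ) = ∫ z, (φ z : ℂ) * 𝓕 (measureFourier μ) z := by
  have hc : HasCompactSupport (fun z => (φ z : ℂ)) := hφc.comp_left (g := Complex.ofReal) rfl
  have hd : ContDiff ℝ (⊤ : ℕ∞) (fun z => (φ z : ℂ)) := Complex.ofRealCLM.contDiff.comp hφ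
  let S : 𝓢(ℂ, ℂ) := hc.toSchwartzMap hd
  have hS : ∀ z, S z = (φ z : ℂ) := fun z => rfl
  have hL : Continuous fun p : ℂ × ℂ => (-innerₗ ℂ) p.1 p.2 := by
    simp only [LinearMap.neg_apply, innerₗ_apply_apply]
    fun_prop
  have hflip : (-innerₗ ℂ).flip = -innerₗ ℂ := by
    ext x y
    simp [real_inner_comm]
  have h1 := VectorFourier.integral_fourierIntegral_smul_eq_flip (μ := μ) (ν := volume)
    (L := -innerₗ ℂ) (f := fun _ => (1 : ℂ)) (g := 𝓕 (S : ℂ → ℂ)) Real.continuous_fourierChar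
    hL (integrable_const _) (𝓕 S).integrable
  rw [← measureFourier_eq_fourierIntegral, hflip] at h1
  have h2 : VectorFourier.fourierIntegral Real.fourierChar volume (-innerₗ ℂ) (𝓕 (S : ℂ → ℂ)) =
      fun z => (φ z : ℂ) :=
    Continuous.fourierInv_fourier_eq S.continuous S.integrable (𝓕 S).integrable
  rw [h2] at h1
  have h3 := VectorFourier.integral_fourierIntegral_smul_eq_flip (μ := volume) (ν := volume)
    (L := innerₗ ℂ) (f := measureFourier μ) (g := (S : ℂ → ℂ)) Real.continuous_fourierChar
    continuous_inner hI S.integrable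
  rw [flip_innerₗ] at h3
  calc ((∫ z, φ z ∂μ : ℝ) : ℂ) = ∫ z, (1 : ℂ) • (φ z : ℂ) ∂μ := by
        simp only [one_smul]
        exact integral_ofReal.symm
    _ = ∫ ξ, measureFourier μ ξ • 𝓕 (S : ℂ → ℂ) ξ := h1.symm
    _ = ∫ z, 𝓕 (measureFourier μ) z • S z := h3.symm
    _ = _ := by
        refine integral_congr_ae (Eventually.of_forall fun z => ?_)
        simp only [smul_eq_mul, hS]
        ring

/-- A finite measure whose pairing with test functions is given by a continuous function has that
function as density. -/
theorem eq_withDensity_of_integral_eq {μ : Measure ℂ} [IsFiniteMeasure μ] {f : ℂ → ℝ}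
    (hf : Continuous f)
    (h : ∀ φ : ℂ → ℝ, ContDiff ℝ (⊤ : ℕ∞) φ → HasCompactSupport φ → ∫ z, φ z ∂μ = ∫ z, φ z * f z) :
    (∀ z, 0 ≤ f z) ∧ μ = volume.withDensity (fun z => ENNReal.ofReal (f z)) := by
  have hint : ∀ U : Set ℂ, Bornology.IsBounded U → IntegrableOn f U := fun U hUb =>
    (hf.continuousOn.integrableOn_compact hUb.isCompact_closure).mono_set subset_closure
  have hopen : ∀ U : Set ℂ, IsOpen U → Bornology.IsBounded U → μ.real U = ∫ z in U, f z := by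
    intro U hU hUb
    obtain ⟨g, hgs, hgd, hgr⟩ := hU.exists_contDiff_support_eq (n := ⊤)
    have hg : ∀ z, 0 ≤ g z ∧ g z ≤ 1 := fun z => hgr (mem_range_self z)
    -- These functions are smooth, supported in `U`, and increase to its indicator.
    set φ : ℕ → ℂ → ℝ := fun n z => 1 - (1 - g z) ^ n with hφ
    have hφd : ∀ n, ContDiff ℝ (⊤ : ℕ∞) (φ n) := fun n =>
      contDiff_const.sub ((contDiff_const.sub hgd).pow n)
    have hφ0 : ∀ n, ∀ z ∉ U, φ n z = 0 := by
      intro n z hz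
      have : g z = 0 := by rwa [← hgs, Function.notMem_support] at hz
      simp [hφ, this]
    have hφb : ∀ n z, |φ n z| ≤ 1 := by
      intro n z
      have h1 : 0 ≤ (1 - g z) ^ n := pow_nonneg (by linarith [(hg z).2]) n
      have h2 : (1 - g z) ^ n ≤ 1 := pow_le_one₀ (by linarith [(hg z).2]) (by linarith [(hg z).1])
      rw [abs_le]
      constructor <;> simp only [hφ] <;> linarith
    have hφc : ∀ n, HasCompactSupport (φ n) := fun n =>
      HasCompactSupport.of_support_subset_isCompact hUb.isCompact_closure fun z hz =>
        subset_closure (by_contra fun hzU => hz (hφ0 n z hzU))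
    have hlim : ∀ z, Tendsto (fun n => φ n z) atTop (𝓝 (U.indicator 1 z)) := by
      intro z
      by_cases hz : z ∈ U
      · have hgz : g z ≠ 0 := by rwa [← Function.mem_support, hgs]
        have h1 := tendsto_pow_atTop_nhds_zero_of_lt_one (r := 1 - g z) (by linarith [(hg z).2])
          (by linarith [lt_of_le_of_ne (hg z).1 hgz.symm])
        simpa [hz, hφ] using h1.const_sub 1
      · simp [hz, hφ0 _ z hz]
    have h1 : Tendsto (fun n => ∫ z, φ n z ∂μ) atTop (𝓝 (μ.real U)) := by
      have := tendsto_integral_of_dominated_convergence (μ := μ) (F := φ) (f := U.indicator 1)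
        (fun _ => (1 : ℝ)) (fun n => (hφd n).continuous.aestronglyMeasurable) (integrable_const _)
        (fun n => Eventually.of_forall fun z => hφb n z) (Eventually.of_forall hlim)
      rwa [integral_indicator_one hU.measurableSet] at this
    have h2 : Tendsto (fun n => ∫ z, φ n z * f z) atTop (𝓝 (∫ z in U, f z)) := by
      rw [← integral_indicator hU.measurableSet]
      refine tendsto_integral_of_dominated_convergence (U.indicator fun z => |f z|)
        (fun n => ((hφd n).continuous.mul hf).aestronglyMeasurable)
        (IntegrableOn.integrable_indicator (hint U hUb).abs hU.measurableSet)
        (fun n => Eventually.of_forall fun z => ?_) (Eventually.of_forall fun z => ?_)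
      · by_cases hz : z ∈ U
        · rw [indicator_of_mem hz, Real.norm_eq_abs, abs_mul]
          exact mul_le_of_le_one_left (abs_nonneg _) (hφb n z)
        · simp [hz, hφ0 n z hz]
      · have := (hlim z).mul_const (f z)
        by_cases hz : z ∈ U
        · simpa [hz] using this
        · simpa [hz] using this
    refine tendsto_nhds_unique h1 (h2.congr fun n => (h _ (hφd n) (hφc n)).symm)
  have hnn : ∀ z, 0 ≤ f z := by
    intro z₀
    by_contra! hneg
    obtain ⟨r, hr, hball⟩ := Metric.eventually_nhds_iff_ball.1
      (hf.continuousAt.eventually_lt_const (show f z₀ < f z₀ / 2 by linarith))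
    have h1 := hopen _ (Metric.isOpen_ball (x := z₀) (ε := r)) Metric.isBounded_ball
    have h2 : ∫ z in Metric.ball z₀ r, f z ≤ ∫ z in Metric.ball z₀ r, f z₀ / 2 :=
      setIntegral_mono_on (hint _ Metric.isBounded_ball)
        (integrableOn_const measure_ball_lt_top.ne) measurableSet_ball fun z hz => (hball z hz).le
    rw [setIntegral_const, smul_eq_mul, ← h1] at h2
    have h3 : 0 < volume.real (Metric.ball z₀ r) :=
      ENNReal.toReal_pos (Metric.measure_ball_pos _ _ hr).ne' measure_ball_lt_top.ne
    have h4 : (0 : ℝ) ≤ μ.real (Metric.ball z₀ r) := measureReal_nonneg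
    nlinarith
  refine ⟨hnn, ?_⟩
  have heq : ∀ U : Set ℂ, IsOpen U → Bornology.IsBounded U →
      μ U = volume.withDensity (fun z => ENNReal.ofReal (f z)) U := by
    intro U hU hUb
    rw [withDensity_apply _ hU.measurableSet,
      ← ofReal_integral_eq_lintegral_ofReal (hint U hUb) (Eventually.of_forall hnn),
      ← hopen U hU hUb, ofReal_measureReal]
  refine Measure.ext_of_generateFrom_of_cover (S := {s | IsOpen s})
    (T := range fun n : ℕ => Metric.ball (0 : ℂ) n) (BorelSpace.measurable_eq) (countable_range _)
    isPiSystem_isOpen ?_ ?_ ?_ ?_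
  · rw [sUnion_range]
    exact Metric.iUnion_ball_nat 0
  · exact fun t _ => measure_ne_top _ _
  · rintro _ ⟨n, rfl⟩ s hs
    exact heq _ (IsOpen.inter hs Metric.isOpen_ball)
      (Metric.isBounded_ball.subset inter_subset_right)
  · rintro _ ⟨n, rfl⟩
    exact heq _ Metric.isOpen_ball Metric.isBounded_ball

/-- In the plane, Fourier decay with an exponent above `k + 2` gives a `C^k` density. -/
theorem HasFourierDecay.hasCkDensity {μ : Measure ℂ} [IsProbabilityMeasure μ] {k : ℕ} {s : ℝ}
    (h : HasFourierDecay μ s) (hs : k + 2 < s) : HasCkDensity k μ := by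
  have hmeas := measurable_measureFourier μ
  have hI : Integrable (measureFourier μ) := by
    have := integrable_pow_mul_measureFourier hs h (Nat.zero_le k)
    simp only [pow_zero, one_mul] at this
    exact (integrable_norm_iff hmeas.aestronglyMeasurable).1 this
  set f : ℂ → ℝ := fun z => (𝓕 (measureFourier μ) z).re with hf
  have hsmooth : ContDiff ℝ (k : ℕ∞) (𝓕 (measureFourier μ)) :=
    Real.contDiff_fourier fun n hn =>
      integrable_pow_mul_measureFourier hs h (by exact_mod_cast hn)
  have hfs : ContDiff ℝ k f := Complex.reCLM.contDiff.comp hsmooth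
  obtain ⟨hnn, hμ⟩ := eq_withDensity_of_integral_eq (μ := μ) hfs.continuous fun φ hφ hφc => by
    have h1 := integral_eq_integral_mul_fourier_measureFourier hI hφ hφc
    have h2 : Integrable fun z => (φ z : ℂ) * 𝓕 (measureFourier μ) z := by
      refine Continuous.integrable_of_hasCompactSupport ?_ ?_
      · exact (Complex.continuous_ofReal.comp hφ.continuous).mul hsmooth.continuous
      · exact (hφc.comp_left (g := Complex.ofReal) rfl).mul_right
    calc ∫ z, φ z ∂μ = (((∫ z, φ z ∂μ : ℝ) : ℂ)).re := (Complex.ofReal_re _).symm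
      _ = ∫ z, ((φ z : ℂ) * 𝓕 (measureFourier μ) z).re := by
          rw [h1]
          exact (Complex.reCLM.integral_comp_comm h2).symm
      _ = ∫ z, φ z * f z := by simp only [Complex.re_ofReal_mul, hf]
  refine ⟨hμ ▸ withDensity_absolutelyContinuous _ _, f, hfs, ?_⟩
  have h3 : μ.rnDeriv volume =ᵐ[volume] fun z => ENNReal.ofReal (f z) := by
    conv_lhs => rw [hμ]
    exact Measure.rnDeriv_withDensity _ hfs.continuous.measurable.ennreal_ofReal
  filter_upwards [h3] with z hz
  rw [hz, ENNReal.toReal_ofReal (hnn z)]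

/-! ### Passing to powers of the parameter -/

/-- The self-similar measure for `lam` is a convolution of `m` rescaled copies of the one for
`lam ^ m`. -/
theorem charFun_selfSimilarMeasure_eq_prod {Λ : Type u} [Fintype Λ] {lam : ℂ} (hlam : ‖lam‖ < 1)
    (a : Λ → ℂ) {p : Λ → ℝ} (hp : p ∈ openSimplex Λ) {m : ℕ} (hm : m ≠ 0) (t : ℂ) :
    charFun (selfSimilarMeasure lam a p) t = ∏ j ∈ Finset.range m,
      charFun (selfSimilarMeasure (lam ^ m) a p) ((starRingEnd ℂ) lam ^ j * t) := by
  have hlamm : ‖lam ^ m‖ < 1 := by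
    rw [norm_pow]
    exact pow_lt_one₀ (norm_nonneg _) hlam hm
  have hs := isSelfSimilarMeasure_selfSimilarMeasure hlam a hp
  have hs' := isSelfSimilarMeasure_selfSimilarMeasure hlamm a hp
  have := hs.1
  have := hs'.1
  set c := (starRingEnd ℂ) lam with hc
  set f : ℂ → ℂ := fun t => charFun (selfSimilarMeasure lam a p) t with hf
  set g : ℂ → ℂ := fun t => ∏ j ∈ Finset.range m,
    charFun (selfSimilarMeasure (lam ^ m) a p) (c ^ j * t) with hg
  have hfrec : ∀ t, f t = (∏ j ∈ Finset.range m, digitCharFun a p (c ^ j * t)) * f (c ^ m * t) :=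
    fun t => hs.charFun_eq_prod hp t m
  have hgrec : ∀ t, g t = (∏ j ∈ Finset.range m, digitCharFun a p (c ^ j * t)) * g (c ^ m * t) := by
    intro t
    rw [hg, ← Finset.prod_mul_distrib]
    refine Finset.prod_congr rfl fun j _ => ?_
    rw [hs'.charFun_eq hp, map_pow, ← digitCharFun, mul_left_comm]
  have hle : ∀ t, ‖f t - g t‖ ≤ ‖f (c ^ m * t) - g (c ^ m * t)‖ := by
    intro t
    rw [hfrec, hgrec, ← mul_sub, norm_mul]
    refine mul_le_of_le_one_left (norm_nonneg _) ?_
    rw [norm_prod]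
    exact Finset.prod_le_one (fun _ _ => norm_nonneg _) fun _ _ => norm_digitCharFun_le_one a hp _
  have hle' : ∀ n : ℕ, ‖f t - g t‖ ≤ ‖f ((c ^ m) ^ n * t) - g ((c ^ m) ^ n * t)‖ := by
    intro n
    induction n with
    | zero => simp
    | succ n ih =>
      refine ih.trans ((hle _).trans (le_of_eq ?_))
      rw [← mul_assoc, ← pow_succ']
  have hlim : Tendsto (fun n : ℕ => (c ^ m) ^ n * t) atTop (𝓝 0) := by
    have : Tendsto (fun n : ℕ => (c ^ m) ^ n) atTop (𝓝 0) :=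
      tendsto_pow_atTop_nhds_zero_of_norm_lt_one (by
        rw [hc, ← map_pow, RCLike.norm_conj]
        exact hlamm)
    simpa using this.mul_const t
  have hcont : Tendsto (fun s : ℂ => ‖f s - g s‖) (𝓝 0) (𝓝 0) := by
    have hcont : Continuous (fun s : ℂ => ‖f s - g s‖) := by fun_prop
    simpa [hf, hg] using hcont.tendsto 0
  have := ge_of_tendsto' (hcont.comp hlim) hle'
  exact sub_eq_zero.1 (norm_le_zero_iff.1 this)

theorem HasFourierDecay.of_pow {Λ : Type u} [Fintype Λ] {lam : ℂ} (hlam : ‖lam‖ < 1)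
    (hlam0 : lam ≠ 0) {a : Λ → ℂ} {p : Λ → ℝ} (hp : p ∈ openSimplex Λ) {m : ℕ} (hm : m ≠ 0) {γ : ℝ}
    (h : HasFourierDecay (selfSimilarMeasure (lam ^ m) a p) γ) :
    HasFourierDecay (selfSimilarMeasure lam a p) (γ * m) := by
  obtain ⟨C, hC, h⟩ := h
  have hl : 0 < ‖lam‖ := norm_pos_iff.2 hlam0
  refine ⟨∏ j ∈ Finset.range m, C * (‖lam‖ ^ j) ^ (-γ), Finset.prod_pos fun j _ => by positivity,
    fun ξ hξ => ?_⟩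
  have e : ‖ξ‖ ^ (-(γ * m)) = ∏ j ∈ Finset.range m, ‖ξ‖ ^ (-γ) := by
    rw [Finset.prod_const, Finset.card_range, ← Real.rpow_natCast, ← Real.rpow_mul (norm_nonneg _),
      neg_mul]
  rw [measureFourier_eq_charFun, charFun_selfSimilarMeasure_eq_prod hlam a hp hm, norm_prod, e,
    ← Finset.prod_mul_distrib]
  refine Finset.prod_le_prod (fun _ _ => norm_nonneg _) fun j _ => ?_
  have hne : (starRingEnd ℂ) lam ^ j * ξ ≠ 0 :=
    mul_ne_zero (pow_ne_zero _ ((map_ne_zero _).2 hlam0)) hξ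
  have := h _ hne
  rw [measureFourier_eq_charFun, norm_mul, norm_pow, RCLike.norm_conj,
    Real.mul_rpow (by positivity) (norm_nonneg _)] at this
  rw [mul_left_comm, mul_assoc C]
  exact this

/-! ### Dimension of preimages under powers -/

/-- A set mapped into `E` by a function with nonvanishing derivative has dimension at most that of
`E`. -/
theorem dimH_le_of_hasStrictDerivAt {f f' : ℂ → ℂ} {S E : Set ℂ} (hSE : ∀ x ∈ S, f x ∈ E)
    (hf : ∀ x ∈ S, HasStrictDerivAt f (f' x) x) (hf' : ∀ x ∈ S, f' x ≠ 0) :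
    dimH S ≤ dimH E := by
  by_contra! hlt
  obtain ⟨x, hx, hxt⟩ := exists_mem_nhdsWithin_lt_dimH_of_lt_dimH hlt
  have hd := (hf x hx).hasStrictFDerivAt_equiv (hf' x hx)
  obtain ⟨s, hxs, hs, happ⟩ := hd.approximates_deriv_on_open_nhds
  have hanti := happ.antilipschitz
    ((ContinuousLinearEquiv.subsingleton_or_nnnorm_symm_pos _).imp id fun h =>
      half_lt_self (inv_pos.2 h))
  refine (hxt (S ∩ s) (inter_mem_nhdsWithin S (hs.mem_nhds hxs))).not_ge ?_
  calc dimH (S ∩ s) ≤ dimH (Subtype.val '' (s.domRestrict f ⁻¹' E)) := by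
        refine dimH_mono fun y hy => ⟨⟨y, hy.2⟩, hSE y hy.1, rfl⟩
    _ = dimH (s.domRestrict f ⁻¹' E) := isometry_subtype_coe.dimH_image _
    _ ≤ dimH E := hanti.dimH_preimage_le E

theorem dimH_setOf_inv_pow_mem_le (E : Set ℂ) {m : ℕ} (hm : m ≠ 0) :
    dimH {z : ℂ | z ≠ 0 ∧ z⁻¹ ^ m ∈ E} ≤ dimH E := by
  have he : ∀ z : ℂ, z⁻¹ ^ m = z ^ (-(m : ℤ)) := fun z => by
    rw [zpow_neg, zpow_natCast, inv_pow]
  refine dimH_le_of_hasStrictDerivAt (f := fun z => z ^ (-(m : ℤ)))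
    (f' := fun z => ((-(m : ℤ) : ℤ) : ℂ) * z ^ (-(m : ℤ) - 1)) ?_ ?_ ?_
  · rintro z ⟨-, hz⟩
    rwa [he] at hz
  · rintro z ⟨hz, -⟩
    exact hasStrictDerivAt_zpow _ _ (Or.inl hz)
  · rintro z ⟨hz, -⟩
    refine mul_ne_zero ?_ (zpow_ne_zero _ hz)
    simpa using hm

/-! ### Parameters without decay or without smooth density -/

theorem one_lt_norm_inv {lam : ℂ} (hlam : ‖lam‖ < 1) (hlami : lam.im ≠ 0) : 1 < ‖lam⁻¹‖ := by
  have hlam0 : lam ≠ 0 := by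
    rintro rfl
    simp at hlami
  rw [norm_inv]
  exact (one_lt_inv₀ (norm_pos_iff.2 hlam0)).2 hlam

theorem abs_im_le_abs_im_inv {lam : ℂ} (hlam : ‖lam‖ < 1) (hlami : lam.im ≠ 0) :
    |lam.im| ≤ |(lam⁻¹).im| := by
  have hlam0 : lam ≠ 0 := by
    rintro rfl
    simp at hlami
  rw [Complex.inv_im, abs_div, abs_neg, Complex.normSq_eq_norm_sq, abs_of_nonneg (sq_nonneg ‖lam‖),
    le_div_iff₀ (by positivity)]
  exact mul_le_of_le_one_right (abs_nonneg _) (pow_le_one₀ (norm_nonneg _) hlam.le)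

/-- One set of dimension zero contains all exceptional parameters, for all digits and weights. -/
theorem exists_dimH_zero_exceptional :
    ∃ E : Set ℂ, E ⊆ {lam : ℂ | ‖lam‖ < 1 ∧ lam.im ≠ 0} ∧ dimH E = 0 ∧
      ∀ (Λ : Type u) [Fintype Λ] (a : Λ → ℂ) (p : Λ → ℝ), (∃ i j, a i ≠ a j) → p ∈ openSimplex Λ →
        ∀ lam : ℂ, ‖lam‖ < 1 → lam.im ≠ 0 → lam ∉ E →
          ∃ γ : ℝ, 0 < γ ∧ HasFourierDecay (selfSimilarMeasure lam a p) γ := by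
  have hpos : ∀ m : ℕ, (0 : ℝ) < 1 / (m + 1) := fun m => by positivity
  choose E hE H using fun m l : ℕ => exists_exceptional_fourierDecay.{u} (s := 1 / (l + 1))
    (by positivity) (b₁ := 1 + 1 / (m + 1)) (b₂ := m + 3) (η := 1 / (m + 1))
    (by linarith [hpos m])
    (by
      have : (1 : ℝ) / (m + 1) ≤ 1 := by
        rw [div_le_one (by positivity)]
        linarith [(Nat.cast_nonneg m : (0 : ℝ) ≤ m)]
      linarith [(Nat.cast_nonneg m : (0 : ℝ) ≤ m)]) (hpos m)
  set E' : Set ℂ := ⋃ m, ⋂ l, E m l with hE'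
  have hdim : dimH E' = 0 := by
    rw [hE', dimH_iUnion]
    simp [fun m => dimH_iInter_eq_zero (hE m)]
  refine ⟨{lam | (‖lam‖ < 1 ∧ lam.im ≠ 0) ∧ lam⁻¹ ∈ E'}, fun lam h => h.1, ?_, ?_⟩
  · refine nonpos_iff_eq_zero.1 ((dimH_mono ?_).trans
      ((dimH_setOf_inv_pow_mem_le E' one_ne_zero).trans hdim.le))
    rintro lam ⟨⟨-, h⟩, h'⟩
    refine ⟨?_, by simpa using h'⟩
    rintro rfl
    simp at h
  · intro Λ _ a p ha hp lam hlam hlami hlamE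
    have h1 := one_lt_norm_inv hlam hlami
    have h2 : 0 < |(lam⁻¹).im| := (abs_pos.2 hlami).trans_le (abs_im_le_abs_im_inv hlam hlami)
    obtain ⟨m, hm⟩ := exists_nat_gt (max ‖lam⁻¹‖ (max (1 / (‖lam⁻¹‖ - 1)) (1 / |(lam⁻¹).im|)))
    rw [max_lt_iff, max_lt_iff] at hm
    have h3 : ∀ x : ℝ, 0 < x → 1 / x < m → 1 / ((m : ℝ) + 1) < x := by
      intro x hx hxm
      rw [div_lt_iff₀ hx] at hxm
      rw [div_lt_iff₀ (by positivity)]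
      nlinarith
    have h4 : lam⁻¹ ∉ ⋂ l, E m l := fun h => hlamE ⟨⟨hlam, hlami⟩, mem_iUnion.2 ⟨m, h⟩⟩
    rw [mem_iInter, not_forall] at h4
    obtain ⟨l, hl⟩ := h4
    obtain ⟨γ, hγ, h⟩ := H m l Λ p hp
    exact ⟨γ, hγ, h a ha lam (by linarith [h3 _ (sub_pos.2 h1) hm.2.1]) (by linarith [hm.1])
      (h3 _ h2 hm.2.2) hl⟩

/-- Some power of `θ` has modulus in `[2, 8]` and is bounded away from the real axis: two
consecutive powers of `θ` cannot both be close to it. -/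
theorem exists_pow_mem_annulus {θ : ℂ} {η : ℝ} (h1 : 1 < ‖θ‖) (h2 : ‖θ‖ ≤ 2) (hη : 0 < η)
    (hη1 : η ≤ 1) (hθη : η < |θ.im|) :
    ∃ m : ℕ, m ≠ 0 ∧ 2 ≤ ‖θ ^ m‖ ∧ ‖θ ^ m‖ ≤ 8 ∧ η / 4 < |(θ ^ m).im| := by
  obtain ⟨n, hn, hn'⟩ := exists_nat_pow_near (one_le_two (α := ℝ)) h1
  set u := θ ^ (n + 1) with hu
  have hu1 : 2 < ‖u‖ := by rw [hu, norm_pow]; exact hn'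
  have hu2 : ‖u‖ ≤ 4 := by
    rw [hu, norm_pow, pow_succ]
    nlinarith [norm_nonneg θ]
  by_cases hui : η / 4 < |u.im|
  · exact ⟨n + 1, by omega, hu1.le, by linarith, hui⟩
  · push Not at hui
    have hv : θ ^ (n + 2) = u * θ := pow_succ _ _
    refine ⟨n + 2, by omega, ?_, ?_, ?_⟩
    · rw [hv, norm_mul]
      nlinarith
    · rw [hv, norm_mul]
      nlinarith [norm_nonneg θ]
    · rw [hv, Complex.mul_im]
      have hure : 1 ≤ |u.re| := by
        linarith [Complex.norm_le_abs_re_add_abs_im u]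
      have h3 : |u.im * θ.re| ≤ η / 4 * 2 := by
        rw [abs_mul]
        gcongr
        exact (Complex.abs_re_le_norm θ).trans h2
      have h4 : η < |u.re * θ.im| := by
        rw [abs_mul]
        nlinarith [abs_nonneg θ.im]
      have h5 := abs_sub_abs_le_abs_sub (u.re * θ.im) (-(u.im * θ.re))
      rw [abs_neg, sub_neg_eq_add] at h5
      linarith

/-- As `|lam| → 1`, parameters without a `C^k` density become exceptional for Fourier decay of
`lam ^ m` with large `m`. -/
theorem tendsto_dimH_not_hasCkDensity (k : ℕ) {η : ℝ} (hη : 0 < η) {Λ : Type u} [Fintype Λ]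
    {a : Λ → ℂ} {p : Λ → ℝ} (ha : ∃ i j, a i ≠ a j) (hp : p ∈ openSimplex Λ) :
    Tendsto (fun δ : ℝ =>
        dimH {lam : ℂ | lam.im ≠ 0 ∧ ‖lam‖ ∈ Ioo (1 - δ) 1 ∧ η < |lam.im| ∧
          ¬ HasCkDensity k (selfSimilarMeasure lam a p)})
      (𝓝[>] 0) (𝓝 0) := by
  rw [ENNReal.tendsto_nhds_zero]
  intro ε hε
  obtain ⟨s, hs0, hsε⟩ := ENNReal.lt_iff_exists_nnreal_btwn.1 hε
  have hη' : 0 < min η 1 := lt_min hη one_pos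
  obtain ⟨E, hE, H⟩ := exists_exceptional_fourierDecay.{u} (s := s) (by exact_mod_cast hs0)
    (b₁ := 2) (b₂ := 8) (η := min η 1 / 4) (by norm_num) (by norm_num) (by positivity)
  obtain ⟨γ, hγ, hdecay⟩ := H Λ p hp
  obtain ⟨m₀, hm₀⟩ := exists_nat_gt (((k : ℝ) + 2) / γ)
  have hδ : ∀ᶠ δ : ℝ in 𝓝[>] 0, 1 / 2 < (1 - δ) ^ m₀ ∧ 1 / 2 < 1 - δ := by
    refine (Eventually.and ?_ ?_).filter_mono nhdsWithin_le_nhds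
    · have h : ContinuousAt (fun δ : ℝ => (1 - δ) ^ m₀) 0 := by fun_prop
      exact h.eventually_const_lt (by norm_num)
    · have h : ContinuousAt (fun δ : ℝ => 1 - δ) 0 := by fun_prop
      exact h.eventually_const_lt (by norm_num)
  filter_upwards [hδ] with δ hδ
  refine le_trans ?_ hsε.le
  calc _ ≤ dimH (⋃ m : {m : ℕ // m ≠ 0}, {z : ℂ | z ≠ 0 ∧ z⁻¹ ^ m.1 ∈ E}) := by
        refine dimH_mono ?_
        rintro lam ⟨hlami, ⟨hlam, hlam1⟩, hlamη, hCk⟩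
        have hlam0 : lam ≠ 0 := by
          rintro rfl
          simp at hlami
        have hlow : 1 / 2 < ‖lam‖ := by linarith [hδ.2]
        have hθ2 : ‖lam⁻¹‖ ≤ 2 := by
          rw [norm_inv]
          exact inv_le_of_inv_le₀ (by norm_num) (by linarith)
        obtain ⟨m, hm, hm1, hm2, hm3⟩ := exists_pow_mem_annulus (one_lt_norm_inv hlam1 hlami) hθ2
          hη' (min_le_right _ _)
          ((min_le_left _ _).trans_lt (hlamη.trans_le (abs_im_le_abs_im_inv hlam1 hlami)))
        refine mem_iUnion.2 ⟨⟨m, hm⟩, hlam0, ?_⟩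
        by_contra hmE
        rw [inv_pow] at hm1 hm2 hm3 hmE
        have hmm : m₀ ≤ m := by
          by_contra! hc
          have h1 : (1 - δ) ^ m₀ ≤ ‖lam‖ ^ m := by
            calc (1 - δ) ^ m₀ ≤ ‖lam‖ ^ m₀ := by
                  gcongr
                  linarith [hδ.2]
              _ ≤ ‖lam‖ ^ m := pow_le_pow_of_le_one (norm_nonneg _) hlam1.le hc.le
          rw [norm_inv, norm_pow] at hm1
          have h2 : ‖lam‖ ^ m ≤ 2⁻¹ := by
            rw [← inv_inv (‖lam‖ ^ m)]
            exact inv_anti₀ (by norm_num) hm1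
          linarith [hδ.1]
        have h3 := (hdecay a ha (lam ^ m) hm1 hm2 hm3 hmE).of_pow hlam1 hlam0 hp hm
        have := (isSelfSimilarMeasure_selfSimilarMeasure hlam1 a hp).1
        refine hCk (h3.hasCkDensity ?_)
        rw [div_lt_iff₀ hγ] at hm₀
        have h4 : (m₀ : ℝ) ≤ m := by exact_mod_cast hmm
        nlinarith
    _ ≤ s := by
        rw [dimH_iUnion]
        exact iSup_le fun m => (dimH_setOf_inv_pow_mem_le E m.2).trans hE

end

theorem mainTheorem4 :
    -- (i), first part
    (∃ E : Set ℂ, E ⊆ {lam : ℂ | ‖lam‖ < 1 ∧ lam.im ≠ 0} ∧ dimH E = 0 ∧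
      ∀ (Λ : Type u) [Fintype Λ] (a : Λ → ℂ) (p : Λ → ℝ), (∃ i j, a i ≠ a j) → p ∈ openSimplex Λ →
        ∀ lam : ℂ, ‖lam‖ < 1 → lam.im ≠ 0 → lam ∉ E →
          ∃ γ : ℝ, 0 < γ ∧ HasFourierDecay (selfSimilarMeasure lam a p) γ) ∧
    -- (i), quantitative part
    (∀ ε b₁ b₂ η : ℝ, 0 < ε → 1 < b₁ → b₁ < b₂ → 0 < η →
      ∃ E : Set ℂ, E ⊆ regionH b₁ b₂ η ∧ dimH E < ENNReal.ofReal ε ∧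
        ∀ (Λ : Type u) [Fintype Λ] (p : Λ → ℝ), p ∈ openSimplex Λ →
          ∃ γ : ℝ, 0 < γ ∧ ∀ a : Λ → ℂ, (∃ i j, a i ≠ a j) →
            ∀ lam : ℂ, lam⁻¹ ∈ regionH b₁ b₂ η \ E →
              HasFourierDecay (selfSimilarMeasure lam a p) γ) ∧
    -- (ii)
    (∀ lam : ℂ, ‖lam‖ < 1 → lam.im ≠ 0 →
      ∃ E : Set ℂ, dimH E = 0 ∧
        ∀ (Λ : Type u) [Fintype Λ] (a : Λ → ℂ) (p : Λ → ℝ), 3 ≤ Fintype.card Λ →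
          p ∈ openSimplex Λ →
          (∃ i j k : Λ, i ≠ j ∧ i ≠ k ∧ j ≠ k ∧ a i ≠ a j ∧ (a k - a i) / (a j - a i) ∉ E) →
            ∃ γ : ℝ, 0 < γ ∧ HasFourierDecay (selfSimilarMeasure lam a p) γ) ∧
    -- (iii)
    (∀ (k : ℕ) (η : ℝ), 0 < η →
      ∀ (Λ : Type u) [Fintype Λ] (a : Λ → ℂ) (p : Λ → ℝ), 2 ≤ Fintype.card Λ →
        Function.Injective a → p ∈ openSimplex Λ →
        Tendsto (fun δ : ℝ =>
            dimH {lam : ℂ | lam.im ≠ 0 ∧ ‖lam‖ ∈ Ioo (1 - δ) 1 ∧ η < |lam.im| ∧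
              ¬ HasCkDensity k (selfSimilarMeasure lam a p)})
          (𝓝[>] 0) (𝓝 0)) := by
  refine ⟨exists_dimH_zero_exceptional, ?_, ?_, ?_⟩
  · intro ε b₁ b₂ η hε hb₁ hb hη
    obtain ⟨E, hE, H⟩ := exists_exceptional_fourierDecay.{u} (s := (ε / 2).toNNReal)
      (Real.toNNReal_pos.2 (by linarith)) hb₁ hb hη
    refine ⟨E ∩ regionH b₁ b₂ η, inter_subset_right, ?_, fun Λ _ p hp => ?_⟩
    · exact ((dimH_mono inter_subset_left).trans hE).trans_lt
        ((ENNReal.ofReal_lt_ofReal_iff hε).2 (by linarith))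
    · obtain ⟨γ, hγ, h⟩ := H Λ p hp
      exact ⟨γ, hγ, fun a ha lam hlam => h a ha lam hlam.1.1 hlam.1.2.1
        (hlam.1.2.2.trans_le (le_abs_self _)) fun hlamE => hlam.2 ⟨hlamE, hlam.1⟩⟩
  · intro lam hlam hlami
    obtain ⟨E, hE, H⟩ := exists_exceptional_ratio_fourierDecay.{u} hlam hlami
    exact ⟨E, hE, fun Λ _ a p _ hp ⟨i, j, k, _, _, _, hij, ht⟩ => H Λ a p hp i j k hij ht⟩
  · intro k η hη Λ _ a p hΛ ha hp
    obtain ⟨i, j, hij⟩ := Fintype.one_lt_card_iff.1 hΛ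
    exact tendsto_dimH_not_hasCkDensity k hη ⟨i, j, ha.ne hij⟩ hp
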